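/- Let $\mathcal{L}=\mathrm{Der}\,\mathbb{C}[t_1^{\pm1},t_2^{\pm1}]$ and, for $\alpha\in\mathbb{Z}^2$, $i=1,2$, put $d_i(\alpha)=t^\alpha\,(t_i\,\partial/\partial t_i)$ and $\mathcal{L}_\alpha=\mathbb{C}d_1(\alpha)\oplus\mathbb{C}d_2(\alpha)$. Order $\mathbb{Z}^2$ lexicographically and let $\mathcal{L}^+=\bigoplus_{\alpha>0}\mathcal{L}_\alpha$ and $\mathfrak{b}^-=\bigoplus_{\alpha\le 0}\mathcal{L}_\alpha$. Let $\varepsilon_2=(0,1)$ and let $\psi:\mathcal{L}^+\to\mathbb{C}$ be a nonsingular Lie algebra homomorphism, i.e. $\psi(d_1(\varepsilon_2))$, $\psi(d_2(\varepsilon_2))$ and $\psi(d_2(2\varepsilon_2))$ are all nonzero. A Whittaker vector of type $\psi$ in an $\mathcal{L}$-module is a nonzero vector $v$ with $xv=\psi(x)v$ for all $x\in\mathcal{L}^+$; a Whittaker module of type $\psi$ is an $\mathcal{L}$-module generated by a Whittaker vector of type $\psi$. Let $\mathbb{C}_\psi$ be the one-dimensional $\mathcal{L}^+$-module given by $\psi$,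 let $W_\psi=U(\mathcal{L})\otimes_{U(\mathcal{L}^+)}\mathbb{C}_\psi$, $w=1\otimes1\in W_\psi$ and $z=d_1(0)$. For every $a\in\mathbb{C}$, the subspace $U(\mathfrak{b}^-)(z-a)w$ is an $\mathcal{L}$-submodule of $W_\psi$, and the quotient $L_{\psi,a}=W_\psi/U(\mathfrak{b}^-)(z-a)w$ is a simple Whittaker $\mathcal{L}$-module of type $\psi$. Conversely, every simple Whittaker $\mathcal{L}$-module of type $\psi$ is isomorphic to $L_{\psi,a}$ for some $a\in\mathbb{C}$. -/

import Mathlib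

open scoped TensorProduct

noncomputable section

namespace TorusWhittaker

/-! ### The derivation Lie algebra of the two-variable Laurent polynomial ring -/

/-- The Laurent polynomial ring `ℂ[t₁^{±1}, t₂^{±1}]`, as the group algebra of `ℤ²`. -/
def Laurent : Type := AddMonoidAlgebra ℂ (Fin 2 → ℤ)

instance : CommRing Laurent := inferInstanceAs (CommRing (AddMonoidAlgebra ℂ (Fin 2 → ℤ)))

instance : Algebra ℂ Laurent := inferInstanceAs (Algebra ℂ (AddMonoidAlgebra ℂ (Fin 2 → ℤ)))

/-- The basis of the Laurent polynomial ring formed by the monomials `t^α`. -/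
def monomials : Module.Basis (Fin 2 → ℤ) ℂ Laurent :=
  Module.Basis.ofRepr (AddMonoidAlgebra.coeffLinearEquiv ℂ :
    AddMonoidAlgebra ℂ (Fin 2 → ℤ) ≃ₗ[ℂ] ((Fin 2 → ℤ) →₀ ℂ))

/-- The monomial `t^α = t₁^{α₁} t₂^{α₂}`. -/
def tpow (α : Fin 2 → ℤ) : Laurent := (AddMonoidAlgebra.single α 1 : AddMonoidAlgebra ℂ _)

theorem monomials_apply (α : Fin 2 → ℤ) : monomials α = tpow α := rfl

theorem monomial_induction {P : Laurent → Prop} (f : Laurent) (zero : P 0)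
    (add : ∀ f g, P f → P g → P (f + g)) (smul : ∀ (c : ℂ) f, P f → P (c • f))
    (coe : ∀ α, P (tpow α)) : P f := by
  have hf : f ∈ Submodule.span ℂ (Set.range monomials) := by
    rw [monomials.span_eq]; exact Submodule.mem_top
  induction hf using Submodule.span_induction with
  | zero => exact zero
  | add x y _ _ hx hy => exact add x y hx hy
  | smul c x _ hx => exact smul c x hx
  | mem x hx => obtain ⟨α, rfl⟩ := hx; exact coe α

theorem tpow_mul (α β : Fin 2 → ℤ) : tpow α * tpow β = tpow (α + β) :=
  (AddMonoidAlgebra.single_mul_single (R := ℂ) α β 1 1).trans (by rw [one_mul]; rfl)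

/-- The linear map underlying `tᵢ ∂/∂tᵢ`, sending `t^β` to `βᵢ t^β`. -/
def eulerLin (i : Fin 2) : Laurent →ₗ[ℂ] Laurent :=
  monomials.constr ℂ fun β => (β i : ℂ) • tpow β

theorem eulerLin_tpow (i : Fin 2) (β : Fin 2 → ℤ) : eulerLin i (tpow β) = (β i : ℂ) • tpow β := by
  rw [← monomials_apply, eulerLin, Module.Basis.constr_basis, monomials_apply]

theorem eulerLin_mul (i : Fin 2) (a b : Laurent) :
    eulerLin i (a * b) = a • eulerLin i b + b • eulerLin i a := by
  induction a using monomial_induction with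
  | zero => simp
  | add f g hf hg => simp only [add_mul, map_add, hf, hg, add_smul, smul_add]; abel
  | smul c f hf =>
    simp only [smul_mul_assoc, map_smul, hf, smul_add, smul_eq_mul, mul_smul_comm]
  | coe α =>
    induction b using monomial_induction with
    | zero => simp
    | add f g hf hg => simp only [mul_add, map_add, hf, hg, add_smul, smul_add]; abel
    | smul c f hf =>
      simp only [smul_mul_assoc, map_smul, hf, smul_add, smul_eq_mul, mul_smul_comm]
    | coe β =>
      simp only [tpow_mul, eulerLin_tpow, smul_eq_mul, mul_smul_comm]
      rw [add_comm β α, ← add_smul, Pi.add_apply, Int.cast_add, add_comm (α i : ℂ)]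

/-- The derivation `tᵢ ∂/∂tᵢ` of the Laurent polynomial ring. -/
def euler (i : Fin 2) : Derivation ℂ Laurent Laurent :=
  Derivation.mk' (eulerLin i) (eulerLin_mul i)

/-- The Lie algebra `𝓛 = Der ℂ[t₁^{±1}, t₂^{±1}]` of all `ℂ`-linear derivations, with the
commutator bracket. -/
abbrev Der : Type := Derivation ℂ Laurent Laurent

/-- `dᵢ(α) = t^α (tᵢ ∂/∂tᵢ)`; the index `i : Fin 2` is zero-based. -/
def d (i : Fin 2) (α : Fin 2 → ℤ) : Der := tpow α • euler i

theorem d_tpow (i : Fin 2) (α β : Fin 2 → ℤ) :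
    d i α (tpow β) = (β i : ℂ) • tpow (α + β) := by
  rw [d, Derivation.smul_apply, euler, Derivation.coe_mk', eulerLin_tpow, smul_eq_mul,
    mul_smul_comm, tpow_mul]

theorem lie_d (i j : Fin 2) (α β : Fin 2 → ℤ) :
    ⁅d i α, d j β⁆ = (β i : ℂ) • d j (α + β) - (α j : ℂ) • d i (α + β) := by
  ext f
  induction f using monomial_induction with
  | zero => simp
  | add f g hf hg => rw [map_add, map_add, hf, hg]
  | smul c f hf => rw [Derivation.map_smul, Derivation.map_smul, hf]
  | coe γ =>
    rw [Derivation.commutator_apply]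
    simp only [Derivation.sub_apply, Derivation.smul_apply, d_tpow,
      Derivation.map_smul, ← add_assoc, smul_smul]
    rw [add_comm β α, ← sub_smul, ← sub_smul]
    congr 1
    simp only [Pi.add_apply, Int.cast_add]
    ring

/-- For a subset `S` of `ℤ²` closed under addition, the subalgebra `⨁_{α ∈ S} 𝓛_α`, where
`𝓛_α = ℂ d₁(α) ⊕ ℂ d₂(α)`. -/
def gradedSubalgebra (S : AddSubsemigroup (Fin 2 → ℤ)) : LieSubalgebra ℂ Der where
  toSubmodule := Submodule.span ℂ {x | ∃ i : Fin 2, ∃ α ∈ S, x = d i α}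
  lie_mem' := by
    intro x y hx hy
    change x ∈ Submodule.span ℂ _ at hx
    change y ∈ Submodule.span ℂ _ at hy
    change ⁅x, y⁆ ∈ Submodule.span ℂ _
    induction hx using Submodule.span_induction with
    | zero => rw [zero_lie]; exact Submodule.zero_mem _
    | add u v _ _ hu hv => rw [add_lie]; exact Submodule.add_mem _ hu hv
    | smul c u _ hu => rw [smul_lie]; exact Submodule.smul_mem _ c hu
    | mem u hu =>
      obtain ⟨i, α, hα, rfl⟩ := hu
      induction hy using Submodule.span_induction with
      | zero => rw [lie_zero]; exact Submodule.zero_mem _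
      | add u v _ _ hu hv => rw [lie_add]; exact Submodule.add_mem _ hu hv
      | smul c u _ hu => rw [lie_smul]; exact Submodule.smul_mem _ c hu
      | mem v hv =>
        obtain ⟨j, β, hβ, rfl⟩ := hv
        rw [lie_d]
        exact Submodule.sub_mem _
          (Submodule.smul_mem _ _ (Submodule.subset_span ⟨j, α + β, S.add_mem hα hβ, rfl⟩))
          (Submodule.smul_mem _ _ (Submodule.subset_span ⟨i, α + β, S.add_mem hα hβ, rfl⟩))

/-- The elements of `ℤ²` that are positive in the lexicographic order. -/
def posCone : AddSubsemigroup (Fin 2 → ℤ) where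
  carrier := {α | 0 < toLex α}
  add_mem' := fun {a b} (ha : 0 < toLex a) (hb : 0 < toLex b) => by
    change 0 < toLex (a + b)
    rw [toLex_add]
    exact add_pos ha hb

/-- The elements of `ℤ²` that are nonpositive in the lexicographic order. -/
def nonposCone : AddSubsemigroup (Fin 2 → ℤ) where
  carrier := {α | toLex α ≤ 0}
  add_mem' := fun {a b} (ha : toLex a ≤ 0) (hb : toLex b ≤ 0) => by
    change toLex (a + b) ≤ 0
    rw [toLex_add]
    exact add_nonpos ha hb

/-- `𝓛⁺ = ⨁_{α > 0} 𝓛_α`. -/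
def Lplus : LieSubalgebra ℂ Der := gradedSubalgebra posCone

/-- `𝔟⁻ = 𝓛⁻ ⊕ 𝔥 = ⨁_{α ≤ 0} 𝓛_α`. -/
def bminus : LieSubalgebra ℂ Der := gradedSubalgebra nonposCone

/-- `ε₂ = (0, 1)`. -/
def eps2 : Fin 2 → ℤ := ![0, 1]

/-- `Ω = {d₁(ε₂), d₂(ε₂), d₂(2ε₂)}`. -/
def Omega : Set Der := {d 0 eps2, d 1 eps2, d 1 (2 • eps2)}

/-- A Lie algebra homomorphism `ψ : 𝓛⁺ → ℂ` is nonsingular if `ψ(x) ≠ 0` for all `x ∈ Ω`. -/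
def Nonsingular (ψ : LieAlgebra.LieCharacter ℂ Lplus) : Prop :=
  ∀ x : Lplus, (x : Der) ∈ Omega → ψ x ≠ 0

/-! ### Whittaker modules -/

section Whittaker

variable (V : Type*) [AddCommGroup V] [Module ℂ V] [LieRingModule Der V]

variable {V} in
/-- A Whittaker vector of type `ψ`: a nonzero `v` with `x v = ψ(x) v` for all `x ∈ 𝓛⁺`. -/
def IsWhittakerVector (ψ : LieAlgebra.LieCharacter ℂ Lplus) (v : V) : Prop :=
  v ≠ 0 ∧ ∀ x : Lplus, ⁅(x : Der), v⁆ = ψ x • v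

/-- A Whittaker module of type `ψ`: an `𝓛`-module generated by a Whittaker vector of type `ψ`. -/
def IsWhittakerModule (ψ : LieAlgebra.LieCharacter ℂ Lplus) : Prop :=
  ∃ w : V, IsWhittakerVector ψ w ∧ LieSubmodule.lieSpan ℂ Der {w} = ⊤

end Whittaker

/-! ### The universal Whittaker module -/

attribute [local instance 100] LieRing.ofAssociativeRing

/-- `U(𝓛)`. -/
abbrev UL : Type := UniversalEnvelopingAlgebra ℂ Der

/-- The homomorphism `U(K) → U(𝓛)` induced by the inclusion of a Lie subalgebra `K` of `𝓛`. -/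
def inclU (K : LieSubalgebra ℂ Der) : UniversalEnvelopingAlgebra ℂ K →ₐ[ℂ] UL :=
  UniversalEnvelopingAlgebra.lift ℂ ((UniversalEnvelopingAlgebra.ι ℂ).comp K.incl)

/-- The extension of `ψ` to `U(𝓛⁺) → ℂ`; it gives the action of `U(𝓛⁺)` on `ℂ_ψ`. -/
def extU (ψ : LieAlgebra.LieCharacter ℂ Lplus) : UniversalEnvelopingAlgebra ℂ Lplus →ₐ[ℂ] ℂ :=
  UniversalEnvelopingAlgebra.lift ℂ ψ

/-- The `U(𝓛)`-submodule of `U(𝓛) ⊗_ℂ ℂ` generated by the elements `u v ⊗ c - u ⊗ v · c` with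
`u ∈ U(𝓛)`, `v ∈ U(𝓛⁺)` and `c ∈ ℂ_ψ`. -/
def balanced (ψ : LieAlgebra.LieCharacter ℂ Lplus) : Submodule UL (UL ⊗[ℂ] ℂ) :=
  Submodule.span UL {x | ∃ (u : UL) (v : UniversalEnvelopingAlgebra ℂ Lplus) (c : ℂ),
    x = (u * inclU Lplus v) ⊗ₜ[ℂ] c - u ⊗ₜ[ℂ] (extU ψ v * c)}

/-- The module `W_ψ = U(𝓛) ⊗_{U(𝓛⁺)} ℂ_ψ`. -/
def W (ψ : LieAlgebra.LieCharacter ℂ Lplus) : Type := (UL ⊗[ℂ] ℂ) ⧸ balanced ψ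

variable (ψ : LieAlgebra.LieCharacter ℂ Lplus)

instance : AddCommGroup (W ψ) := inferInstanceAs (AddCommGroup ((UL ⊗[ℂ] ℂ) ⧸ balanced ψ))

instance : Module UL (W ψ) := inferInstanceAs (Module UL ((UL ⊗[ℂ] ℂ) ⧸ balanced ψ))

instance : Module ℂ (W ψ) := inferInstanceAs (Module ℂ ((UL ⊗[ℂ] ℂ) ⧸ balanced ψ))

instance : IsScalarTower ℂ UL (W ψ) :=
  inferInstanceAs (IsScalarTower ℂ UL ((UL ⊗[ℂ] ℂ) ⧸ balanced ψ))

/-- `𝓛` acts on `W_ψ` through `U(𝓛)`. -/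
instance : LieRingModule Der (W ψ) where
  bracket x m := UniversalEnvelopingAlgebra.ι ℂ x • m
  add_lie x y m := by
    change UniversalEnvelopingAlgebra.ι ℂ (x + y) • m = _
    rw [map_add, add_smul]
  lie_add x m n := smul_add _ m n
  leibniz_lie x y m := by
    change UniversalEnvelopingAlgebra.ι ℂ x • UniversalEnvelopingAlgebra.ι ℂ y • m =
      UniversalEnvelopingAlgebra.ι ℂ ⁅x, y⁆ • m +
        UniversalEnvelopingAlgebra.ι ℂ y • UniversalEnvelopingAlgebra.ι ℂ x • m
    rw [LieHom.map_lie, LieRing.of_associative_ring_bracket, sub_smul, mul_smul, mul_smul]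
    exact (sub_add_cancel _ _).symm

theorem W.lie_def (x : Der) (m : W ψ) : ⁅x, m⁆ = UniversalEnvelopingAlgebra.ι ℂ x • m := rfl

instance : LieModule ℂ Der (W ψ) where
  smul_lie c x m := by
    rw [W.lie_def, W.lie_def, map_smul, smul_assoc]
  lie_smul c x m := by
    rw [W.lie_def, W.lie_def, ← algebraMap_smul UL c m, ← mul_smul, ← Algebra.commutes, mul_smul,
      algebraMap_smul]

/-- The cyclic Whittaker vector `w = 1 ⊗ 1` of `W_ψ`. -/
def w : W ψ := Submodule.Quotient.mk (p := balanced ψ) ((1 : UL) ⊗ₜ[ℂ] (1 : ℂ))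

/-- The element `z = d₁(0)` of `U(𝓛)`. -/
def z : UL := UniversalEnvelopingAlgebra.ι ℂ (d 0 0)

/-- The subset `U(𝔟⁻)(z - a)w` of `W_ψ`. -/
def orbit (a : ℂ) : Set (W ψ) :=
  {m | ∃ u : UniversalEnvelopingAlgebra ℂ bminus,
    m = inclU bminus u • (z - algebraMap ℂ UL a) • w ψ}

/-- The `𝓛`-submodule of `W_ψ` generated by `U(𝔟⁻)(z - a)w`. -/
def N (a : ℂ) : LieSubmodule ℂ Der (W ψ) := LieSubmodule.lieSpan ℂ Der (orbit ψ a)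

/-- The `𝓛`-module `L_{ψ,a} = W_ψ / U(𝔟⁻)(z - a)w`, formed with the submodule `N ψ a`. -/
abbrev L (a : ℂ) : Type := W ψ ⧸ N ψ a

end TorusWhittaker

end

noncomputable section

namespace TorusWhittaker

attribute [local instance 100] LieRing.ofAssociativeRing

/-! ### The monomial basis of the derivation algebra -/

/-! Write `d₁, d₂` for `d 0, d 1`, and call the two coordinates of `α` its first and second degree.
A character of `𝓛⁺` kills brackets, so `ψ` vanishes on all `dᵢ(α)` of positive first degree. Since
`[z, dᵢ(α)]` is `dᵢ(α)` times its first degree, `z` preserves the space of vectors on which `𝓛⁺`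
acts by `ψ` (`whittaker_lie_z`). Hence `(z - a)w` lies in this space and `U(𝔟⁻)(z - a)w` is a
submodule (`coe_N`). It is proper: `W_ψ` maps to a representation on `U(𝔟⁻)` with `w ↦ 1`, and there
`u(z - a)` is killed by a character of `𝔟⁻` with value `a` at `z` (`w_notMem_N`).

Simplicity and the converse both rest on `exists_vac_mem`. Let `A` be a commutative algebra and `ζ
f`, `f ∈ A`, vectors on which `𝓛⁺` acts by `ψ` and `z` by multiplication by an element of `A`.
Polynomials over `A` in the basis elements of `𝔟⁻` other than `z` are evaluated at these vectors.
For a suitable weight, brackets are of lower order, so vectors have commutative symbols, on which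
the elements `x - ψ(x)` used below act by derivations. With `x = d₁(1, n)`, `n` very negative, one
lowers the first weight to zero; then `d₁(0, n)` and `d₂(0, n)` turn a variable of least second
degree into `d₁(ε₂)`, that is, into the nonzero scalar `ψ(d₁(ε₂))`. The symbol never dies on the
way. So a submodule containing the value of a nonzero polynomial contains `ζ f` for some `f ≠ 0`.

For `A = ℂ` and an eigenvector of `z` this is simplicity. For `A = ℂ[X]` and `ζ f = f(z)v` in a
simple module it shows that `f ↦ f(z)v` is not injective (`polyVec_not_injective`). So `z` has a
Whittaker eigenvector, and Schur's lemma identifies the module with some `L_{ψ,a}`. -/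

theorem tpow_zero : tpow 0 = 1 := rfl

/-- The logarithmic derivative `α ↦ t^(-α) D(t^α)` is additive in `α`, so it is determined by its
values on the two unit vectors. -/
theorem Der.ext_eps {D : Der} (h : ∀ i : Fin 2, D (tpow (Pi.single i 1)) = 0) : D = 0 := by
  let φ : (Fin 2 → ℤ) →+ Laurent :=
    AddMonoidHom.mk' (fun α => tpow (-α) * D (tpow α)) fun α β => by
      rw [← tpow_mul α β, D.leibniz, smul_eq_mul, smul_eq_mul, mul_add, ← mul_assoc, ← mul_assoc,
        tpow_mul, tpow_mul]
      have h1 : -(α + β) + α = -β := by abel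
      have h2 : -(α + β) + β = -α := by abel
      rw [h1, h2, add_comm]
  have hφ : φ = 0 := by
    ext i
    change tpow (-Pi.single i 1) * D (tpow (Pi.single i 1)) = 0
    rw [h, mul_zero]
  ext f
  induction f using monomial_induction with
  | zero => simp
  | add f g hf hg => rw [map_add, hf, hg]; simp
  | smul c f hf => rw [Derivation.map_smul, hf]; simp
  | coe α =>
    have h1 : tpow (-α) * D (tpow α) = 0 := DFunLike.congr_fun hφ α
    have h2 : tpow α * (tpow (-α) * D (tpow α)) = D (tpow α) := by
      rw [← mul_assoc, tpow_mul, add_neg_cancel, tpow_zero, one_mul]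
    rw [← h2, h1, mul_zero]; rfl

/-- The coefficients of a derivation with respect to `t₁ ∂/∂t₁` and `t₂ ∂/∂t₂`. -/
def Der.equivLaurent : Der ≃ₗ[ℂ] (Fin 2 → Laurent) where
  toFun D i := tpow (-Pi.single i 1) * D (tpow (Pi.single i 1))
  map_add' D E := by ext i; simp [mul_add]
  map_smul' c D := by ext i; simp
  invFun f := ∑ i, f i • euler i
  left_inv D := by
    rw [← sub_eq_zero]
    apply Der.ext_eps
    intro j
    have h : ∀ i : Fin 2, euler i (tpow (Pi.single j 1)) =
        (if i = j then (1 : ℂ) else 0) • tpow (Pi.single j 1) := fun i => by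
      change eulerLin i _ = _
      rw [eulerLin_tpow, Pi.single_apply]
      split_ifs <;> simp
    have h2 : tpow (-Pi.single j 1) * D (tpow (Pi.single j 1)) * tpow (Pi.single j 1) =
        D (tpow (Pi.single j 1)) := by
      rw [mul_right_comm, tpow_mul, neg_add_cancel, tpow_zero, one_mul]
    simp only [Derivation.sub_apply, Fin.sum_univ_two, Derivation.add_apply,
      Derivation.smul_apply, h]
    fin_cases j
    · simpa [sub_eq_zero] using h2
    · simpa [sub_eq_zero] using h2
  right_inv f := by
    ext1 j
    have h : ∀ i : Fin 2, euler i (tpow (Pi.single j 1)) =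
        (if i = j then (1 : ℂ) else 0) • tpow (Pi.single j 1) := fun i => by
      change eulerLin i _ = _
      rw [eulerLin_tpow, Pi.single_apply]
      split_ifs <;> simp
    simp only [Fin.sum_univ_two, Derivation.add_apply,
      Derivation.smul_apply, h]
    fin_cases j <;>
    simp [mul_left_comm _ (f _), tpow_mul, tpow_zero]

/-- The basis `d i α` of `𝓛`. -/
def dBasis : Module.Basis (Fin 2 × (Fin 2 → ℤ)) ℂ Der :=
  ((Pi.basis fun _ : Fin 2 => monomials).map Der.equivLaurent.symm).reindex
    (Equiv.sigmaEquivProd (Fin 2) (Fin 2 → ℤ))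

theorem dBasis_apply (u : Fin 2 × (Fin 2 → ℤ)) : dBasis u = d u.1 u.2 := by
  obtain ⟨i, α⟩ := u
  rw [dBasis, Module.Basis.reindex_apply, Module.Basis.map_apply, Equiv.sigmaEquivProd_symm_apply,
    Pi.basis_apply]
  change ∑ j, (Pi.single i (monomials α) : Fin 2 → Laurent) j • euler j = _
  rw [Finset.sum_eq_single i]
  · simp [d, monomials_apply]
  · intro j _ hj
    simp [hj]
  · simp

theorem span_d : Submodule.span ℂ (Set.range fun u : Fin 2 × (Fin 2 → ℤ) => d u.1 u.2) = ⊤ := by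
  rw [← dBasis.span_eq]
  congr 2
  ext u
  rw [dBasis_apply]

/-! ### The lexicographic order on `ℤ²` -/

theorem lex_pos_iff (α : Fin 2 → ℤ) : 0 < toLex α ↔ 0 < α 0 ∨ (α 0 = 0 ∧ 0 < α 1) := by
  change (∃ i, (∀ j, j < i → (0 : ℤ) = α j) ∧ (0 : ℤ) < α i) ↔ _
  simp [Fin.exists_fin_two, eq_comm]

theorem mem_posCone {α : Fin 2 → ℤ} : α ∈ posCone ↔ 0 < α 0 ∨ (α 0 = 0 ∧ 0 < α 1) :=
  lex_pos_iff α

theorem mem_nonposCone {α : Fin 2 → ℤ} :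
    α ∈ nonposCone ↔ ¬ (0 < α 0 ∨ (α 0 = 0 ∧ 0 < α 1)) := by
  exact (not_lt (a := (0 : Lex (Fin 2 → ℤ)))).symm.trans (not_congr (lex_pos_iff α))

theorem d_mem_Lplus (i : Fin 2) {α : Fin 2 → ℤ} (h : α ∈ posCone) : d i α ∈ Lplus :=
  Submodule.subset_span ⟨i, α, h, rfl⟩

theorem d_mem_bminus (i : Fin 2) {α : Fin 2 → ℤ} (h : α ∈ nonposCone) : d i α ∈ bminus :=
  Submodule.subset_span ⟨i, α, h, rfl⟩

/-! ### Vanishing of `ψ` -/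

section

variable (ψ : LieAlgebra.LieCharacter ℂ Lplus)

theorem character_lie_d {i j : Fin 2} {α β : Fin 2 → ℤ} (hα : α ∈ posCone) (hβ : β ∈ posCone) :
    (β i : ℂ) * ψ ⟨d j (α + β), d_mem_Lplus j (posCone.add_mem hα hβ)⟩ =
      (α j : ℂ) * ψ ⟨d i (α + β), d_mem_Lplus i (posCone.add_mem hα hβ)⟩ := by
  have h := LieAlgebra.lieCharacter_apply_lie ψ ⟨d i α, d_mem_Lplus i hα⟩ ⟨d j β, d_mem_Lplus j hβ⟩
  have h2 : ⁅(⟨d i α, d_mem_Lplus i hα⟩ : Lplus), (⟨d j β, d_mem_Lplus j hβ⟩ : Lplus)⁆ =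
      (β i : ℂ) • ⟨d j (α + β), d_mem_Lplus j (posCone.add_mem hα hβ)⟩ -
      (α j : ℂ) • ⟨d i (α + β), d_mem_Lplus i (posCone.add_mem hα hβ)⟩ :=
    Subtype.ext (lie_d i j α β)
  rw [h2, map_sub, map_smul, map_smul, sub_eq_zero] at h
  exact h

theorem eps2_mem : eps2 ∈ posCone := mem_posCone.2 (by simp [eps2])

/-- Comes from the decomposition `β = ε₂ + (β - ε₂)`. The vanishing statements below follow from
these relations on dividing by a nonzero integer. -/
theorem character_decomp {i j : Fin 2} {β : Fin 2 → ℤ} (hβ : β ∈ posCone)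
    (hβ' : β - eps2 ∈ posCone) :
    ((β i : ℂ) - (eps2 i : ℂ)) * ψ ⟨d j β, d_mem_Lplus j hβ⟩ =
      (eps2 j : ℂ) * ψ ⟨d i β, d_mem_Lplus i hβ⟩ := by
  have h := character_lie_d ψ (i := i) (j := j) eps2_mem hβ'
  simpa using h

theorem character_d_eq_zero_of_pos (i : Fin 2) {α : Fin 2 → ℤ} (h0 : 0 < α 0) (h : α ∈ posCone) :
    ψ ⟨d i α, d_mem_Lplus i h⟩ = 0 := by
  have h' : α - eps2 ∈ posCone := mem_posCone.2 (by simp [eps2, h0])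
  have e1 := character_decomp ψ (i := 0) (j := 0) h h'
  have e2 := character_decomp ψ (i := 0) (j := 1) h h'
  have hne : (α 0 : ℂ) ≠ 0 := by exact_mod_cast h0.ne'
  simp [eps2, hne] at e1 e2
  fin_cases i
  · exact e1
  · simpa [e1, hne] using e2

theorem character_d_zero_eq_zero {α : Fin 2 → ℤ} (h0 : α 0 = 0) (h1 : 2 ≤ α 1) (h : α ∈ posCone) :
    ψ ⟨d 0 α, d_mem_Lplus 0 h⟩ = 0 := by
  have h' : α - eps2 ∈ posCone := mem_posCone.2 (by simp [eps2, h0]; omega)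
  have e1 := character_decomp ψ (i := 1) (j := 0) h h'
  have hne : (α 1 : ℂ) - 1 ≠ 0 := by
    rw [sub_ne_zero]; exact_mod_cast (show α 1 ≠ 1 by omega)
  simpa [eps2, hne] using e1

theorem character_d_one_eq_zero {α : Fin 2 → ℤ} (h0 : α 0 = 0) (h1 : 3 ≤ α 1) (h : α ∈ posCone) :
    ψ ⟨d 1 α, d_mem_Lplus 1 h⟩ = 0 := by
  have h' : α - eps2 ∈ posCone := mem_posCone.2 (by simp [eps2, h0]; omega)
  have e1 := character_decomp ψ (i := 1) (j := 1) h h'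
  have hne : (α 1 : ℂ) - 2 ≠ 0 := by
    rw [sub_ne_zero]; exact_mod_cast (show α 1 ≠ 2 by omega)
  simp only [eps2, Matrix.cons_val_one, Matrix.cons_val_fin_one, Int.cast_one] at e1
  -- Absorbing the right-hand side lowers the coefficient from `α 1 - 1` to `α 1 - 2`, which leaves
  -- the value at `2ε₂` free.
  have : ((α 1 : ℂ) - 2) * ψ ⟨d 1 α, d_mem_Lplus 1 h⟩ = 0 := by linear_combination e1
  simpa [hne] using this

end

/-! ### Modules induced from a character of a complementary subalgebra -/

section Induced

variable {R 𝔤 : Type*} [CommRing R] [LieRing 𝔤] [LieAlgebra R 𝔤]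

/-- The lift of `ι` to `S`, followed by the inclusion of `S`, is the identity by the universal
property. -/
theorem enveloping_mem_subalgebra (S : Subalgebra R (UniversalEnvelopingAlgebra R 𝔤))
    (h : ∀ x : 𝔤, UniversalEnvelopingAlgebra.ι R x ∈ S) (u : UniversalEnvelopingAlgebra R 𝔤) :
    u ∈ S := by
  let f : 𝔤 →ₗ⁅R⁆ S :=
    { toFun := fun x => ⟨UniversalEnvelopingAlgebra.ι R x, h x⟩
      map_add' := fun x y => Subtype.ext (map_add _ x y)
      map_smul' := fun c x => Subtype.ext (map_smul _ c x)
      map_lie' := fun {x y} => Subtype.ext (LieHom.map_lie (UniversalEnvelopingAlgebra.ι R) x y) }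
  have key : S.val.comp (UniversalEnvelopingAlgebra.lift R f) = AlgHom.id R _ := by
    apply UniversalEnvelopingAlgebra.hom_ext
    ext x
    change S.val (UniversalEnvelopingAlgebra.lift R f (UniversalEnvelopingAlgebra.ι R x)) = _
    rw [UniversalEnvelopingAlgebra.lift_ι_apply]
    rfl
  have h2 : ((UniversalEnvelopingAlgebra.lift R f u : S) : UniversalEnvelopingAlgebra R 𝔤) = u :=
    DFunLike.congr_fun key u
  rw [← h2]
  exact (UniversalEnvelopingAlgebra.lift R f u).2

/-- Left induction on the universal enveloping algebra. -/
theorem enveloping_induction (S : Submodule R (UniversalEnvelopingAlgebra R 𝔤)) (one : 1 ∈ S)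
    (mul : ∀ (x : 𝔤), ∀ u ∈ S, UniversalEnvelopingAlgebra.ι R x * u ∈ S)
    (u : UniversalEnvelopingAlgebra R 𝔤) : u ∈ S := by
  -- The elements whose left multiplication preserves `S` form a subalgebra.
  let T : Subalgebra R (UniversalEnvelopingAlgebra R 𝔤) :=
    { carrier := {a | ∀ u ∈ S, a * u ∈ S}
      mul_mem' := fun {a b} ha hb u hu => by rw [mul_assoc]; exact ha _ (hb _ hu)
      add_mem' := fun {a b} ha hb u hu => by rw [add_mul]; exact S.add_mem (ha _ hu) (hb _ hu)
      algebraMap_mem' := fun r u hu => by rw [← Algebra.smul_def]; exact S.smul_mem r hu }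
  have := enveloping_mem_subalgebra T mul u 1 one
  rwa [mul_one] at this

variable (𝔫 : LieSubalgebra R 𝔤)

/-- The action of `𝔫` on linear maps `𝔤 → U(𝔫)`. -/
def homAction :
    𝔫 →ₗ⁅R⁆ Module.End R (𝔤 →ₗ[R] UniversalEnvelopingAlgebra R 𝔫) where
  toFun y :=
    { toFun := fun φ => LinearMap.mulLeft R (UniversalEnvelopingAlgebra.ι R y) ∘ₗ φ -
        φ ∘ₗ LieModule.toEnd R 𝔤 𝔤 (y : 𝔤)
      map_add' := fun φ χ => by ext x; simp [mul_add]; abel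
      map_smul' := fun c φ => by ext x; simp [smul_sub] }
  map_add' y y' := by ext φ x; simp [add_mul]; abel
  map_smul' c y := by ext φ x; simp [smul_sub]
  map_lie' {y y'} := by
    ext φ x
    simp [LieRing.of_associative_ring_bracket, mul_sub, sub_mul, mul_assoc]
    abel

theorem homAction_apply (y : 𝔫) (φ : 𝔤 →ₗ[R] UniversalEnvelopingAlgebra R 𝔫) (x : 𝔤) :
    homAction 𝔫 y φ x = UniversalEnvelopingAlgebra.ι R y * φ x - φ ⁅(y : 𝔤), x⁆ := rfl

variable {𝔫} (R₀ : 𝔤 →ₗ[R] UniversalEnvelopingAlgebra R 𝔫)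

/-- The operators on `U(𝔫)` extending left multiplication by `𝔫`, with prescribed values on `1`. -/
def indAction (x : 𝔤) : Module.End R (UniversalEnvelopingAlgebra R 𝔫) where
  toFun u := UniversalEnvelopingAlgebra.lift R (homAction 𝔫) u R₀ x
  map_add' u v := by simp
  map_smul' c u := by simp

theorem indAction_one (x : 𝔤) : indAction R₀ x 1 = R₀ x := by
  change UniversalEnvelopingAlgebra.lift R (homAction 𝔫) 1 R₀ x = _
  rw [map_one]; rfl

/-- The rule `x(yu) = y(xu) + [x,y]u` is forced in an induced module; the twist in `homAction` is
designed to produce it. It extends the values on `1` to all of `U(𝔫)` with no PBW basis. -/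
theorem indAction_mul (x : 𝔤) (y : 𝔫) (u : UniversalEnvelopingAlgebra R 𝔫) :
    indAction R₀ x (UniversalEnvelopingAlgebra.ι R y * u) =
      UniversalEnvelopingAlgebra.ι R y * indAction R₀ x u + indAction R₀ ⁅x, (y : 𝔤)⁆ u := by
  change UniversalEnvelopingAlgebra.lift R (homAction 𝔫) (_ * u) R₀ x = _ *
    UniversalEnvelopingAlgebra.lift R (homAction 𝔫) u R₀ x +
    UniversalEnvelopingAlgebra.lift R (homAction 𝔫) u R₀ _
  rw [map_mul, UniversalEnvelopingAlgebra.lift_ι_apply, Module.End.mul_apply, homAction_apply,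
    sub_eq_add_neg, ← map_neg, lie_skew]

/-- `indAction` as a linear map. -/
def indActionₗ : 𝔤 →ₗ[R] Module.End R (UniversalEnvelopingAlgebra R 𝔫) where
  toFun := indAction R₀
  map_add' x x' := by ext u; exact map_add (UniversalEnvelopingAlgebra.lift R (homAction 𝔫) u R₀) x x'
  map_smul' c x := by ext u; exact map_smul (UniversalEnvelopingAlgebra.lift R (homAction 𝔫) u R₀) c x

theorem indActionₗ_apply (x : 𝔤) : indActionₗ R₀ x = indAction R₀ x := rfl

variable {R₀}

/-- Induction on `u` for all `y` at once, since moving `y` past a factor `y'` creates `[y, y']`. -/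
theorem indAction_coe (h : ∀ y : 𝔫, R₀ y = UniversalEnvelopingAlgebra.ι R y) (y : 𝔫)
    (u : UniversalEnvelopingAlgebra R 𝔫) :
    indAction R₀ y u = UniversalEnvelopingAlgebra.ι R y * u := by
  let S : Submodule R (UniversalEnvelopingAlgebra R 𝔫) :=
    { carrier := {u | ∀ y : 𝔫, indAction R₀ y u = UniversalEnvelopingAlgebra.ι R y * u}
      zero_mem' := fun y => by simp
      add_mem' := fun {a b} ha hb y => by rw [map_add, ha, hb, mul_add]
      smul_mem' := fun c a ha y => by rw [map_smul, ha, mul_smul_comm] }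
  refine enveloping_induction S (fun y => ?_) (fun y' u hu y => ?_) u y
  · rw [indAction_one, h, mul_one]
  · rw [indAction_mul, hu y, ← LieSubalgebra.coe_bracket, hu ⁅y, y'⁆, LieHom.map_lie,
      LieRing.of_associative_ring_bracket, sub_mul, mul_assoc, mul_assoc, add_sub_cancel]

/-- If `R₀` extends `ι` on `𝔫` and a character on a complementary subalgebra `𝔮`, then the
operators `indAction` form a representation of `𝔤`. -/
theorem indAction_lie {𝔮 : LieSubalgebra R 𝔤} (χ : LieAlgebra.LieCharacter R 𝔮)
    (hn : ∀ y : 𝔫, R₀ y = UniversalEnvelopingAlgebra.ι R y)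
    (hq : ∀ y : 𝔮, R₀ y = algebraMap R _ (χ y))
    (hsup : ∀ x : 𝔤, ∃ y : 𝔫, ∃ y' : 𝔮, x = y + y') (x x' : 𝔤)
    (u : UniversalEnvelopingAlgebra R 𝔫) :
    indAction R₀ ⁅x, x'⁆ u =
      indAction R₀ x (indAction R₀ x' u) - indAction R₀ x' (indAction R₀ x u) := by
  -- When one entry lies in `𝔫` the relation is `indAction_mul`; on the vector `1` only two elements
  -- of `𝔮` then remain to be treated.
  have comm1 : ∀ (x : 𝔤) (y : 𝔫) u, indAction R₀ ⁅x, (y : 𝔤)⁆ u =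
      indAction R₀ x (indAction R₀ y u) - indAction R₀ y (indAction R₀ x u) := fun x y u => by
    rw [indAction_coe hn, indAction_coe hn, indAction_mul, add_sub_cancel_left]
  have comm2 : ∀ (y : 𝔫) (x : 𝔤) u, indAction R₀ ⁅(y : 𝔤), x⁆ u =
      indAction R₀ y (indAction R₀ x u) - indAction R₀ x (indAction R₀ y u) := fun y x u => by
    rw [← lie_skew, ← indActionₗ_apply, map_neg, LinearMap.neg_apply, indActionₗ_apply, comm1,
      neg_sub]
  let S : Submodule R (UniversalEnvelopingAlgebra R 𝔫) :=
    { carrier := {u | ∀ x x' : 𝔤, indAction R₀ ⁅x, x'⁆ u =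
        indAction R₀ x (indAction R₀ x' u) - indAction R₀ x' (indAction R₀ x u)}
      zero_mem' := fun x x' => by simp
      add_mem' := fun {a b} ha hb x x' => by simp only [map_add, ha x x', hb x x']; abel
      smul_mem' := fun c a ha x x' => by simp only [map_smul, ha x x', smul_sub] }
  refine enveloping_induction S (fun x x' => ?_) (fun y u hu x x' => ?_) u x x'
  · obtain ⟨y, q, rfl⟩ := hsup x
    obtain ⟨y', q', rfl⟩ := hsup x'
    -- Elements of `𝔮` act on `1` by scalars, which commute, and the character kills their bracket.
    have hqq : indAction R₀ ⁅(q : 𝔤), (q' : 𝔤)⁆ 1 =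
        indAction R₀ q (indAction R₀ q' 1) - indAction R₀ q' (indAction R₀ q 1) := by
      rw [← LieSubalgebra.coe_bracket, indAction_one, indAction_one, indAction_one, hq, hq, hq,
        LieAlgebra.lieCharacter_apply_lie, Algebra.algebraMap_eq_smul_one,
        Algebra.algebraMap_eq_smul_one, Algebra.algebraMap_eq_smul_one, map_smul, map_smul,
        indAction_one, indAction_one, hq, hq, Algebra.algebraMap_eq_smul_one,
        Algebra.algebraMap_eq_smul_one, smul_smul, smul_smul, mul_comm, sub_self, zero_smul]
    simp only [add_lie, lie_add, ← indActionₗ_apply, map_add, LinearMap.add_apply] at *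
    simp only [indActionₗ_apply] at *
    rw [comm1 q y' 1, comm2 y q' 1, comm1 y y' 1, hqq]
    abel
  · have e : ∀ z : 𝔤, indAction R₀ z (UniversalEnvelopingAlgebra.ι R y * u) =
      UniversalEnvelopingAlgebra.ι R y * indAction R₀ z u + indAction R₀ ⁅z, (y : 𝔤)⁆ u :=
      fun z => indAction_mul R₀ z y u
    have jac : ⁅⁅x, x'⁆, (y : 𝔤)⁆ = ⁅⁅x, (y : 𝔤)⁆, x'⁆ + ⁅x, ⁅x', (y : 𝔤)⁆⁆ := by
      rw [lie_lie x x' (y : 𝔤), ← lie_skew x' ⁅x, (y : 𝔤)⁆]; abel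
    rw [e, e, e, map_add, map_add, indAction_mul, indAction_mul, jac, hu x x',
      ← indActionₗ_apply R₀ (_ + _), map_add, LinearMap.add_apply, indActionₗ_apply,
      indActionₗ_apply, hu ⁅x, (y : 𝔤)⁆ x', hu x ⁅x', (y : 𝔤)⁆, mul_sub]
    abel

end Induced

open UniversalEnvelopingAlgebra (ι lift lift_ι_apply)

theorem gradedSubalgebra_hom_ext {S : AddSubsemigroup (Fin 2 → ℤ)} {M : Type*} [AddCommGroup M]
    [Module ℂ M] {f g : gradedSubalgebra S →ₗ[ℂ] M}
    (h : ∀ i α (hα : α ∈ S), f ⟨d i α, Submodule.subset_span ⟨i, α, hα, rfl⟩⟩ =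
      g ⟨d i α, Submodule.subset_span ⟨i, α, hα, rfl⟩⟩) : f = g := by
  ext ⟨x, hx⟩
  change x ∈ Submodule.span ℂ _ at hx
  induction hx using Submodule.span_induction with
  | zero => exact (map_zero f).trans (map_zero g).symm
  | add u v hu hv hu' hv' =>
    have := congr_arg₂ (· + ·) hu' hv'
    simp only [← map_add] at this
    exact this
  | smul c u hu hu' =>
    have := congr_arg (c • ·) hu'
    simp only [← map_smul] at this
    exact this
  | mem u hu =>
    obtain ⟨i, α, hα, rfl⟩ := hu
    exact h i α hα

variable (ψ : LieAlgebra.LieCharacter ℂ Lplus)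

/-! ### The universal property of `W_ψ` -/

theorem W.exists_smul (m : W ψ) : ∃ u : UL, m = u • w ψ := by
  obtain ⟨t, rfl⟩ := Submodule.Quotient.mk_surjective (balanced ψ) m
  induction t using TensorProduct.induction_on with
  | zero => exact ⟨0, by rw [zero_smul]; rfl⟩
  | add s t hs ht =>
    obtain ⟨u, hu⟩ := hs
    obtain ⟨v, hv⟩ := ht
    refine ⟨u + v, ?_⟩
    rw [add_smul, ← hu, ← hv]
    rfl
  | tmul u c =>
    refine ⟨c • u, ?_⟩
    change _ = Submodule.Quotient.mk (p := balanced ψ) ((c • u) • ((1 : UL) ⊗ₜ[ℂ] (1 : ℂ)))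
    rw [TensorProduct.smul_tmul', smul_eq_mul, mul_one, TensorProduct.smul_tmul, smul_eq_mul,
      mul_one]

theorem inclU_ι (K : LieSubalgebra ℂ Der) (x : K) : inclU K (ι ℂ x) = ι ℂ (x : Der) := by
  rw [inclU, lift_ι_apply]; rfl

theorem ι_smul_w (x : Lplus) : ι ℂ (x : Der) • w ψ = ψ x • w ψ := by
  have h : (ι ℂ (x : Der) ⊗ₜ[ℂ] (1 : ℂ) - (1 : UL) ⊗ₜ[ℂ] (ψ x) : UL ⊗[ℂ] ℂ) ∈ balanced ψ := by
    refine Submodule.subset_span ⟨1, ι ℂ x, 1, ?_⟩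
    rw [one_mul, inclU_ι, extU, lift_ι_apply, mul_one]
  have h2 := (Submodule.Quotient.eq (balanced ψ)).2 h
  change Submodule.Quotient.mk (p := balanced ψ) (ι ℂ (x : Der) • ((1 : UL) ⊗ₜ[ℂ] (1 : ℂ))) =
    Submodule.Quotient.mk (p := balanced ψ) (ψ x • ((1 : UL) ⊗ₜ[ℂ] (1 : ℂ)))
  rw [TensorProduct.smul_tmul', smul_eq_mul, mul_one, h2, TensorProduct.smul_tmul',
    TensorProduct.smul_tmul, smul_eq_mul, mul_one]

section Desc

variable {ψ} {V : Type*} [AddCommGroup V] [Module ℂ V]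

theorem apply_inclU_of_character (Φ : UL →ₐ[ℂ] Module.End ℂ V) {v₀ : V}
    (h : ∀ x : Lplus, Φ (ι ℂ (x : Der)) v₀ = ψ x • v₀)
    (v : UniversalEnvelopingAlgebra ℂ Lplus) : Φ (inclU Lplus v) v₀ = extU ψ v • v₀ := by
  let S : Submodule ℂ (UniversalEnvelopingAlgebra ℂ Lplus) :=
    { carrier := {v | Φ (inclU Lplus v) v₀ = extU ψ v • v₀}
      zero_mem' := by simp
      add_mem' := fun {a b} (ha : _ = _) (hb : _ = _) => by
        change Φ (inclU Lplus (a + b)) v₀ = _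
        simp only [map_add, LinearMap.add_apply, ha, hb, add_smul]
      smul_mem' := fun c a (ha : _ = _) => by
        change Φ (inclU Lplus (c • a)) v₀ = _
        simp only [map_smul, LinearMap.smul_apply, ha, smul_assoc] }
  refine enveloping_induction S ?_ (fun x u (hu : _ = _) => ?_) v
  · change Φ (inclU Lplus 1) v₀ = extU ψ 1 • v₀
    simp
  · change Φ (inclU Lplus _) v₀ = extU ψ _ • v₀
    rw [map_mul, map_mul, Module.End.mul_apply, hu, map_smul, inclU_ι, h, map_mul, extU,
      lift_ι_apply, smul_smul, mul_comm]

/-- The linear map `W_ψ → V` sending `u w` to `u v₀`, for `v₀` on which `𝓛⁺` acts by `ψ`. -/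
def W.desc (Φ : UL →ₐ[ℂ] Module.End ℂ V) (v₀ : V)
    (h : ∀ x : Lplus, Φ (ι ℂ (x : Der)) v₀ = ψ x • v₀) : W ψ →ₗ[ℂ] V :=
  Submodule.liftQ ((balanced ψ).restrictScalars ℂ)
    ((LinearMap.applyₗ v₀ ∘ₗ Φ.toLinearMap) ∘ₗ (TensorProduct.rid ℂ UL).toLinearMap) <| by
    intro t ht
    change t ∈ balanced ψ at ht
    -- The relations are spanned over `UL` while the map is only `ℂ`-linear; the free factor `y`
    -- makes the claim stable under `UL`.
    have key : ∀ y : UL, Φ (TensorProduct.rid ℂ UL (y • t)) v₀ = 0 := by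
      induction ht using Submodule.span_induction with
      | zero => intro y; simp
      | add s t _ _ hs ht => intro y; rw [smul_add]; simp [hs y, ht y]
      | smul a s _ hs => intro y; rw [smul_smul]; exact hs _
      | mem s hs =>
        obtain ⟨u, v, c, rfl⟩ := hs
        intro y
        rw [smul_sub, TensorProduct.smul_tmul', TensorProduct.smul_tmul', map_sub,
          TensorProduct.rid_tmul, TensorProduct.rid_tmul, smul_eq_mul, smul_eq_mul, map_sub,
          map_smul, map_smul, map_mul, map_mul, map_mul, LinearMap.sub_apply,
          LinearMap.smul_apply, LinearMap.smul_apply, Module.End.mul_apply, Module.End.mul_apply,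
          Module.End.mul_apply, apply_inclU_of_character Φ h, map_smul, map_smul, smul_smul,
          mul_comm, sub_self]
    have := key 1
    rwa [one_smul] at this

theorem W.desc_smul_w (Φ : UL →ₐ[ℂ] Module.End ℂ V) (v₀ : V)
    (h : ∀ x : Lplus, Φ (ι ℂ (x : Der)) v₀ = ψ x • v₀) (u : UL) :
    W.desc Φ v₀ h (u • w ψ) = Φ u v₀ := by
  change Φ (TensorProduct.rid ℂ UL (u • ((1 : UL) ⊗ₜ[ℂ] (1 : ℂ)))) v₀ = _
  rw [TensorProduct.smul_tmul', TensorProduct.rid_tmul, one_smul, smul_eq_mul, mul_one]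

variable [LieRingModule Der V] [LieModule ℂ Der V]

/-- The module homomorphism `W_ψ → V` sending `w` to a vector on which `𝓛⁺` acts by `ψ`. -/
def W.descLie (v₀ : V) (h : ∀ x : Lplus, ⁅(x : Der), v₀⁆ = ψ x • v₀) : W ψ →ₗ⁅ℂ, Der⁆ V :=
  { W.desc (lift ℂ (LieModule.toEnd ℂ Der V)) v₀ (fun x => by rw [lift_ι_apply]; exact h x) with
    map_lie' := fun {x m} => by
      obtain ⟨u, rfl⟩ := W.exists_smul ψ m
      rw [W.lie_def, smul_smul]
      change W.desc _ _ _ _ = ⁅x, W.desc _ _ _ _⁆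
      rw [W.desc_smul_w, W.desc_smul_w, map_mul, Module.End.mul_apply, lift_ι_apply]
      rfl }

theorem W.descLie_smul_w (v₀ : V) (h : ∀ x : Lplus, ⁅(x : Der), v₀⁆ = ψ x • v₀) (u : UL) :
    W.descLie v₀ h (u • w ψ) = lift ℂ (LieModule.toEnd ℂ Der V) u v₀ :=
  W.desc_smul_w _ _ (fun x => by rw [lift_ι_apply]; exact h x) u

theorem W.descLie_w (v₀ : V) (h : ∀ x : Lplus, ⁅(x : Der), v₀⁆ = ψ x • v₀) :
    W.descLie v₀ h (w ψ) = v₀ := by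
  have := W.descLie_smul_w v₀ h 1
  rwa [one_smul, map_one] at this

end Desc

/-! ### The action of `z` on Whittaker vectors -/

theorem lie_d_zero (j : Fin 2) (β : Fin 2 → ℤ) : ⁅d 0 0, d j β⁆ = (β 0 : ℂ) • d j β := by
  rw [lie_d]; simp

/-- The commutator of `dᵢ(α)` with `z` is `-(α 0) dᵢ(α)`: either `α 0 = 0`, or `ψ` vanishes on
`dᵢ(α)`. -/
theorem whittaker_lie_z {V : Type*} [AddCommGroup V] [Module ℂ V] [LieRingModule Der V]
    [LieModule ℂ Der V] {v : V} (h : ∀ x : Lplus, ⁅(x : Der), v⁆ = ψ x • v) (x : Lplus) :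
    ⁅(x : Der), ⁅d 0 0, v⁆⁆ = ψ x • ⁅d 0 0, v⁆ := by
  let f : Lplus →ₗ[ℂ] V :=
    (LinearMap.applyₗ ⁅d 0 0, v⁆ ∘ₗ (LieModule.toEnd ℂ Der V : Der →ₗ[ℂ] _)) ∘ₗ
      Lplus.toSubmodule.subtype
  let g : Lplus →ₗ[ℂ] V := (ψ : Lplus →ₗ[ℂ] ℂ).smulRight ⁅d 0 0, v⁆
  have hfg : f = g := by
    refine gradedSubalgebra_hom_ext fun i α hα => ?_
    change ⁅d i α, ⁅d 0 0, v⁆⁆ = ψ ⟨d i α, d_mem_Lplus i hα⟩ • ⁅d 0 0, v⁆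
    have hd : ⁅d i α, v⁆ = ψ ⟨d i α, d_mem_Lplus i hα⟩ • v := h ⟨d i α, d_mem_Lplus i hα⟩
    rw [leibniz_lie, hd, lie_smul, ← lie_skew, neg_lie, lie_d_zero, smul_lie, hd]
    rcases mem_posCone.1 hα with h0 | ⟨h0, -⟩
    · rw [character_d_eq_zero_of_pos ψ i h0 hα]; simp
    · simp [h0]
  exact DFunLike.congr_fun hfg x

/-! ### The submodule `U(𝔟⁻)(z - a)w` -/

theorem exists_bminus_add_Lplus (x : Der) : ∃ y : bminus, ∃ y' : Lplus, x = y + y' := by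
  have hx : x ∈ Submodule.span ℂ (Set.range fun u : Fin 2 × (Fin 2 → ℤ) => d u.1 u.2) := by
    rw [span_d]; exact Submodule.mem_top
  induction hx using Submodule.span_induction with
  | zero => exact ⟨0, 0, by simp⟩
  | add u v _ _ hu hv =>
    obtain ⟨y, y', rfl⟩ := hu
    obtain ⟨q, q', rfl⟩ := hv
    exact ⟨y + q, y' + q', by push_cast; abel⟩
  | smul c u _ hu =>
    obtain ⟨y, y', rfl⟩ := hu
    exact ⟨c • y, c • y', by push_cast; rw [smul_add]⟩
  | mem u hu =>
    obtain ⟨⟨i, α⟩, rfl⟩ := hu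
    by_cases h : α ∈ posCone
    · exact ⟨0, ⟨d i α, d_mem_Lplus i h⟩, by simp⟩
    · exact ⟨⟨d i α, d_mem_bminus i (mem_nonposCone.2 (mt mem_posCone.2 h))⟩, 0, by simp⟩

/-- The orbit map `U(𝔟⁻) → W_ψ` of a vector. -/
def orbitMap (m : W ψ) : UniversalEnvelopingAlgebra ℂ bminus →ₗ[ℂ] W ψ where
  toFun u := inclU bminus u • m
  map_add' u v := by rw [map_add, add_smul]
  map_smul' c u := by rw [map_smul, smul_assoc]; rfl

theorem orbitMap_apply (m : W ψ) (u : UniversalEnvelopingAlgebra ℂ bminus) :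
    orbitMap ψ m u = inclU bminus u • m := rfl

/-- Commute `x` past the factors from `𝔟⁻` until an element of `𝓛` meets `m`, and split that element
along `𝓛 = 𝔟⁻ + 𝓛⁺`. -/
theorem lie_mem_range_orbitMap {m : W ψ} (hm : ∀ x : Lplus, ⁅(x : Der), m⁆ = ψ x • m) (x : Der)
    {n : W ψ} (hn : n ∈ LinearMap.range (orbitMap ψ m)) :
    ⁅x, n⁆ ∈ LinearMap.range (orbitMap ψ m) := by
  have hb : ∀ (y : bminus) {n : W ψ}, n ∈ LinearMap.range (orbitMap ψ m) →
      ⁅(y : Der), n⁆ ∈ LinearMap.range (orbitMap ψ m) := by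
    rintro y _ ⟨u, rfl⟩
    exact ⟨ι ℂ y * u, by rw [orbitMap_apply, map_mul, inclU_ι, mul_smul]; rfl⟩
  obtain ⟨u, rfl⟩ := hn
  let S : Submodule ℂ (UniversalEnvelopingAlgebra ℂ bminus) :=
    { carrier := {u | ∀ x : Der, ⁅x, orbitMap ψ m u⁆ ∈ LinearMap.range (orbitMap ψ m)}
      zero_mem' := fun x => by rw [map_zero, lie_zero]; exact Submodule.zero_mem _
      add_mem' := fun {a b} ha hb x => by
        rw [map_add, lie_add]; exact Submodule.add_mem _ (ha x) (hb x)
      smul_mem' := fun c a ha x => by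
        rw [map_smul, lie_smul]; exact Submodule.smul_mem _ c (ha x) }
  refine enveloping_induction S (fun x => ?_) (fun y u hu x => ?_) u x
  · have h1 : orbitMap ψ m 1 = m := by rw [orbitMap_apply, map_one, one_smul]
    have hmem : m ∈ LinearMap.range (orbitMap ψ m) := ⟨1, h1⟩
    obtain ⟨y, y', rfl⟩ := exists_bminus_add_Lplus x
    rw [h1, add_lie, hm]
    exact Submodule.add_mem _ (hb y hmem) (Submodule.smul_mem _ _ hmem)
  · have h1 : orbitMap ψ m (ι ℂ y * u) = ⁅(y : Der), orbitMap ψ m u⁆ := by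
      rw [orbitMap_apply, map_mul, inclU_ι, mul_smul]; rfl
    rw [h1, leibniz_lie]
    exact Submodule.add_mem _ (hu _) (hb y (hu x))

theorem w_whittaker (x : Lplus) : ⁅(x : Der), w ψ⁆ = ψ x • w ψ := ι_smul_w ψ x

theorem z_sub_smul (a : ℂ) (m : W ψ) : (z - algebraMap ℂ UL a) • m = ⁅d 0 0, m⁆ - a • m := by
  rw [sub_smul, algebraMap_smul]; rfl

theorem z_sub_whittaker (a : ℂ) (x : Lplus) :
    ⁅(x : Der), (z - algebraMap ℂ UL a) • w ψ⁆ = ψ x • (z - algebraMap ℂ UL a) • w ψ := by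
  rw [z_sub_smul, lie_sub, lie_smul, whittaker_lie_z ψ (w_whittaker ψ), w_whittaker, smul_sub,
    smul_comm]

/-- `𝓛⁺` acts by `ψ` on `(z - a)w` too, so its orbit under `U(𝔟⁻)` is already stable under `𝓛`. -/
theorem coe_N (a : ℂ) : (N ψ a : Set (W ψ)) = orbit ψ a := by
  have horb : orbit ψ a = LinearMap.range (orbitMap ψ ((z - algebraMap ℂ UL a) • w ψ)) := by
    ext n
    exact ⟨fun ⟨u, hu⟩ => ⟨u, hu.symm⟩, fun ⟨u, hu⟩ => ⟨u, hu.symm⟩⟩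
  let P : LieSubmodule ℂ Der (W ψ) :=
    { LinearMap.range (orbitMap ψ ((z - algebraMap ℂ UL a) • w ψ)) with
      lie_mem := fun {x n} hn => lie_mem_range_orbitMap ψ (z_sub_whittaker ψ a) x hn }
  apply Set.Subset.antisymm
  · rw [horb]
    exact LieSubmodule.lieSpan_le (N := P).2 horb.le
  · exact LieSubmodule.subset_lieSpan

theorem z_sub_mem_N (a : ℂ) : (z - algebraMap ℂ UL a) • w ψ ∈ N ψ a :=
  LieSubmodule.subset_lieSpan ⟨1, by rw [map_one, one_smul]⟩

/-! ### Properness -/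

open Classical in
/-- The value at `d i α` of the map that extends `ι` on `𝔟⁻` and `ψ` on `𝓛⁺`. -/
def initialValue (u : Fin 2 × (Fin 2 → ℤ)) : UniversalEnvelopingAlgebra ℂ bminus :=
  if h : u.2 ∈ posCone then algebraMap ℂ _ (ψ ⟨d u.1 u.2, d_mem_Lplus u.1 h⟩)
  else ι ℂ ⟨d u.1 u.2, d_mem_bminus u.1 (mem_nonposCone.2 (mt mem_posCone.2 h))⟩

/-- The map `𝓛 → U(𝔟⁻)` that extends `ι` on `𝔟⁻` and `ψ` on `𝓛⁺`. -/
def initialMap : Der →ₗ[ℂ] UniversalEnvelopingAlgebra ℂ bminus :=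
  dBasis.constr ℂ (initialValue ψ)

theorem initialMap_Lplus (x : Lplus) : initialMap ψ x = algebraMap ℂ _ (ψ x) := by
  let f : Lplus →ₗ[ℂ] UniversalEnvelopingAlgebra ℂ bminus :=
    initialMap ψ ∘ₗ Lplus.toSubmodule.subtype
  let g : Lplus →ₗ[ℂ] UniversalEnvelopingAlgebra ℂ bminus :=
    Algebra.linearMap ℂ _ ∘ₗ (ψ : Lplus →ₗ[ℂ] ℂ)
  have hfg : f = g := by
    refine gradedSubalgebra_hom_ext fun i α hα => ?_
    change initialMap ψ (d i α) = algebraMap ℂ _ (ψ ⟨d i α, d_mem_Lplus i hα⟩)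
    have h := dBasis.constr_basis ℂ (initialValue ψ) (i, α)
    rw [dBasis_apply] at h
    exact h.trans (dif_pos hα)
  exact DFunLike.congr_fun hfg x

theorem initialMap_bminus (x : bminus) : initialMap ψ x = ι ℂ x := by
  let f : bminus →ₗ[ℂ] UniversalEnvelopingAlgebra ℂ bminus :=
    initialMap ψ ∘ₗ bminus.toSubmodule.subtype
  let g : bminus →ₗ[ℂ] UniversalEnvelopingAlgebra ℂ bminus := (ι ℂ : bminus →ₗ⁅ℂ⁆ _)
  have hfg : f = g := by
    refine gradedSubalgebra_hom_ext fun i α hα => ?_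
    change initialMap ψ (d i α) = ι ℂ ⟨d i α, d_mem_bminus i hα⟩
    have h := dBasis.constr_basis ℂ (initialValue ψ) (i, α)
    rw [dBasis_apply] at h
    exact h.trans (dif_neg (mt mem_posCone.1 (mem_nonposCone.1 hα)))
  exact DFunLike.congr_fun hfg x

/-- The representation of `𝓛` on `U(𝔟⁻)` that realizes `W_ψ`. -/
def envelopingRep : Der →ₗ⁅ℂ⁆ Module.End ℂ (UniversalEnvelopingAlgebra ℂ bminus) :=
  { indActionₗ (initialMap ψ) with
    map_lie' := fun {x y} => by
      ext u
      exact indAction_lie ψ (initialMap_bminus ψ) (initialMap_Lplus ψ) exists_bminus_add_Lplus x y u }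

theorem envelopingRep_apply (x : Der) (u : UniversalEnvelopingAlgebra ℂ bminus) :
    envelopingRep ψ x u = indAction (initialMap ψ) x u := rfl

theorem lift_envelopingRep_inclU (u v : UniversalEnvelopingAlgebra ℂ bminus) :
    lift ℂ (envelopingRep ψ) (inclU bminus u) v = u * v := by
  have h : (lift ℂ (envelopingRep ψ)).comp (inclU bminus) = Algebra.lmul ℂ _ := by
    apply UniversalEnvelopingAlgebra.hom_ext
    ext x v
    change lift ℂ (envelopingRep ψ) (inclU bminus (ι ℂ x)) v = ι ℂ x * v
    rw [inclU_ι, lift_ι_apply, envelopingRep_apply, indAction_coe (initialMap_bminus ψ)]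
  exact LinearMap.congr_fun (DFunLike.congr_fun h u) v

/-- The character of `𝔟⁻` sending `d₁(0)` to `a` and vanishing on the other `dᵢ(α)`. -/
def bminusCharacter (a : ℂ) : bminus →ₗ⁅ℂ⁆ ℂ :=
  { (a • dBasis.coord (0, 0)) ∘ₗ bminus.toSubmodule.subtype with
    map_lie' := fun {x y} => by
      have hd : ∀ i j α β, α ∈ nonposCone → β ∈ nonposCone →
          dBasis.coord (0, 0) ⁅d i α, d j β⁆ = 0 := by
        intro i j α β hα hβ
        rw [mem_nonposCone] at hα hβ
        -- Nonpositive degrees add up to zero only if both are zero, and `d₁(0)`, `d₂(0)` commute;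
        -- so no bracket in `𝔟⁻` has a `z`-component.
        by_cases h : α + β = 0
        · have h0 : α 0 + β 0 = 0 := congr_fun h 0
          have h1 : α 1 + β 1 = 0 := congr_fun h 1
          have hα0 : α = 0 := by
            ext k; fin_cases k
            · change α 0 = 0; omega
            · change α 1 = 0; omega
          have hβ0 : β = 0 := by simpa [hα0] using h
          rw [lie_d]; simp [hα0, hβ0]
        · rw [lie_d, ← dBasis_apply (j, α + β), ← dBasis_apply (i, α + β)]
          simp [h]
      let B : Der →ₗ[ℂ] Der →ₗ[ℂ] ℂ :=
        (LieModule.toEnd ℂ Der Der : Der →ₗ[ℂ] _).compr₂ (dBasis.coord (0, 0))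
      have h1 : ∀ i α, α ∈ nonposCone → B (d i α) ∘ₗ bminus.toSubmodule.subtype = 0 :=
        fun i α hα => gradedSubalgebra_hom_ext fun j β hβ => hd i j α β hα hβ
      have h2 : (B.compl₂ bminus.toSubmodule.subtype) ∘ₗ bminus.toSubmodule.subtype = 0 :=
        gradedSubalgebra_hom_ext fun i α hα => h1 i α hα
      have h3 : dBasis.coord (0, 0) ⁅(x : Der), (y : Der)⁆ = 0 :=
        LinearMap.congr_fun (LinearMap.congr_fun h2 x) y
      change a * dBasis.coord (0, 0) ⁅(x : Der), (y : Der)⁆ = ⁅_, _⁆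
      rw [h3, mul_zero, LieRing.of_associative_ring_bracket, mul_comm, sub_self] }

/-- If `w = u(z - a)w`, the map to `U(𝔟⁻)` gives `1 = u(z - a)` there, and the character with value
`a` at `z` turns this into `1 = 0`. -/
theorem w_notMem_N (a : ℂ) : w ψ ∉ N ψ a := by
  intro hw
  have hw' : w ψ ∈ orbit ψ a := by rw [← coe_N]; exact hw
  obtain ⟨u, hu⟩ := hw'
  let Φ := lift ℂ (envelopingRep ψ)
  have hΦ : ∀ x : Lplus, Φ (ι ℂ (x : Der)) 1 = ψ x • (1 : UniversalEnvelopingAlgebra ℂ bminus) := by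
    intro x
    rw [lift_ι_apply, envelopingRep_apply, indAction_one, initialMap_Lplus,
      Algebra.algebraMap_eq_smul_one]
  have h0 : (0 : Fin 2 → ℤ) ∈ nonposCone := mem_nonposCone.2 (by simp)
  have key := congr_arg (W.desc Φ 1 hΦ) hu
  have h1 : W.desc Φ 1 hΦ (w ψ) = 1 := by
    have := W.desc_smul_w Φ 1 hΦ 1
    rwa [one_smul, map_one Φ] at this
  have hz : Φ z 1 = ι ℂ ⟨d 0 0, d_mem_bminus 0 h0⟩ := by
    rw [z, lift_ι_apply, envelopingRep_apply, indAction_one]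
    exact initialMap_bminus ψ ⟨d 0 0, d_mem_bminus 0 h0⟩
  rw [h1, smul_smul, W.desc_smul_w, map_mul, Module.End.mul_apply, lift_envelopingRep_inclU,
    map_sub, AlgHom.commutes, LinearMap.sub_apply, hz, Module.algebraMap_end_apply] at key
  have key2 := congr_arg (lift ℂ (bminusCharacter a)) key
  have hc : bminusCharacter a ⟨d 0 0, d_mem_bminus 0 h0⟩ = a := by
    change a * dBasis.coord (0, 0) (d 0 0) = a
    rw [← dBasis_apply (0, 0)]; simp
  rw [map_mul, map_sub, lift_ι_apply, hc, map_smul, map_one, smul_eq_mul, mul_one, sub_self,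
    mul_zero] at key2
  exact one_ne_zero key2

/-! ### Weight filtrations on cyclic modules and their symbols -/

section Filtration

set_option linter.unusedSectionVars false

open MvPolynomial (X C monomial coeff)

variable {k 𝔤 V I A Γ : Type*} [CommRing k] [LieRing 𝔤] [LieAlgebra k 𝔤] [AddCommGroup V]
  [Module k V] [LieRingModule 𝔤 V] [LieModule k 𝔤 V] [CommRing A] [Algebra k A]
  [AddCommGroup Γ] [LinearOrder Γ] [IsOrderedAddMonoid Γ]
  (b : I → 𝔤) {gen : Set I} (ζ : A →ₗ[k] V) (wt : I → Γ) (s : I → k)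

variable (k) in
/-- The iterated action of a list of elements. -/
def act : List gen → Module.End k V
  | [] => LinearMap.id
  | y :: l => LieModule.toEnd k 𝔤 V (b y) ∘ₗ act l

theorem act_nil (v : V) : act k b ([] : List gen) v = v := rfl

theorem act_cons (y : gen) (l : List gen) (v : V) : act k b (y :: l) v = ⁅b y, act k b l v⁆ := rfl

/-- The weight of a list. -/
def listWt : List gen → Γ
  | [] => 0
  | y :: l => wt y + listWt l

/-- The exponent of the commutative monomial of a list. -/
def expo : List gen → (gen →₀ ℕ)
  | [] => 0
  | y :: l => Finsupp.single y 1 + expo l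

theorem toMultiset_expo (l : List gen) : Finsupp.toMultiset (expo l) = (l : Multiset gen) := by
  induction l with
  | nil => simp [expo]
  | cons y l ih => rw [expo, map_add, ih, Finsupp.toMultiset_single]; simp

theorem listWt_perm {l l' : List gen} (h : l.Perm l') : listWt wt l = listWt wt l' := by
  induction h with
  | nil => rfl
  | cons x _ ih => rw [listWt, ih, listWt]
  | swap x y l => simp only [listWt]; abel
  | trans _ _ h1 h2 => exact h1.trans h2

theorem listWt_nonneg (h : ∀ y : gen, 0 ≤ wt y) (l : List gen) : 0 ≤ listWt wt l := by
  induction l with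
  | nil => exact le_rfl
  | cons y l ih => exact add_nonneg (h y) ih

theorem le_listWt (h : ∀ y : gen, 0 ≤ wt y) {l : List gen} {y : gen} (hy : y ∈ l) :
    wt y ≤ listWt wt l := by
  induction l with
  | nil => cases hy
  | cons x l ih =>
    rcases List.mem_cons.1 hy with rfl | hy
    · exact le_add_of_nonneg_right (listWt_nonneg wt h l)
    · exact (ih hy).trans (le_add_of_nonneg_left (h x))

/-- The span of the vectors `act l (ζ f)` with `l` of weight less than `ω`. -/
def ltSpan (gen : Set I) (ω : Γ) : Submodule k V :=
  Submodule.span k {v | ∃ (l : List gen) (f : A), listWt wt l < ω ∧ v = act k b l (ζ f)}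

/-- The span of the vectors `act l (ζ f)` with `l` of weight at most `ω`. -/
def leSpan (gen : Set I) (ω : Γ) : Submodule k V :=
  Submodule.span k {v | ∃ (l : List gen) (f : A), listWt wt l ≤ ω ∧ v = act k b l (ζ f)}

/-- The span of the `b u` with `u` of weight less than `ω`. -/
def ltLie (ω : Γ) : Submodule k 𝔤 := Submodule.span k (b '' {u | wt u < ω})

/-- Compatibility of the weights with the bracket and with the action on the vectors `ζ f`. -/
structure IsFrame (gen : Set I) : Prop where
  lie_mem : ∀ u v, ⁅b u, b v⁆ ∈ ltLie (k := k) b wt (wt u + wt v)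
  wt_eq_zero : ∀ u, s u ≠ 0 → wt u = 0
  -- The empty list has weight zero, so a nonzero error `ζ f'` is of lower order only when `wt u` is
  -- positive.
  lie_vac : ∀ u ∉ gen, ∀ f : A, ∃ f', ⁅b u, ζ f⁆ - s u • ζ f = ζ f' ∧ (f' = 0 ∨ 0 < wt u)

variable {b ζ wt s}

theorem leSpan_le_ltSpan {ω ω' : Γ} (h : ω < ω') : leSpan b ζ wt gen ω ≤ ltSpan b ζ wt gen ω' :=
  Submodule.span_mono fun _ ⟨l, f, hl, e⟩ => ⟨l, f, hl.trans_lt h, e⟩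

theorem ltSpan_le_leSpan (ω : Γ) : ltSpan b ζ wt gen ω ≤ leSpan b ζ wt gen ω :=
  Submodule.span_mono fun _ ⟨l, f, hl, e⟩ => ⟨l, f, hl.le, e⟩

theorem act_mem_leSpan (l : List gen) (f : A) :
    act k b l (ζ f) ∈ leSpan b ζ wt gen (listWt wt l) :=
  Submodule.subset_span ⟨l, f, le_rfl, rfl⟩

theorem lie_mem_ltSpan_of_gen (y : gen) {ω : Γ} {v : V} (hv : v ∈ ltSpan b ζ wt gen ω) :
    ⁅b y, v⁆ ∈ ltSpan b ζ wt gen (wt y + ω) := by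
  induction hv using Submodule.span_induction with
  | zero => rw [lie_zero]; exact Submodule.zero_mem _
  | add _ _ _ _ h h' => rw [lie_add]; exact Submodule.add_mem _ h h'
  | smul c _ _ h => rw [lie_smul]; exact Submodule.smul_mem _ c h
  | mem v hv =>
    obtain ⟨l, f, hl, rfl⟩ := hv
    exact Submodule.subset_span ⟨y :: l, f, add_lt_add_right hl _, rfl⟩

/-- Elements of `ltLie ω` lower the filtration accordingly, once the basis elements do. -/
theorem ltLie_lie_mem {ω ω' : Γ} {x : 𝔤} (hx : x ∈ ltLie (k := k) b wt ω) {v : V}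
    (h : ∀ u, ⁅b u, v⁆ ∈ leSpan b ζ wt gen (wt u + ω')) :
    ⁅x, v⁆ ∈ ltSpan b ζ wt gen (ω + ω') := by
  induction hx using Submodule.span_induction with
  | zero => rw [zero_lie]; exact Submodule.zero_mem _
  | add _ _ _ _ h h' => rw [add_lie]; exact Submodule.add_mem _ h h'
  | smul c _ _ h => rw [smul_lie]; exact Submodule.smul_mem _ c h
  | mem x hx =>
    obtain ⟨u, hu, rfl⟩ := hx
    exact leSpan_le_ltSpan (add_lt_add_left hu _) (h u)

namespace IsFrame

variable (F : IsFrame b ζ wt s gen)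
include F

/-- Moving `b u` past each `b y` costs a bracket of strictly smaller weight; at the end of the list
`lie_vac` applies. -/
theorem lie_act_of_notMem (l : List gen) (f : A) {u : I} (hu : u ∉ gen) :
    ⁅b u, act k b l (ζ f)⁆ - s u • act k b l (ζ f) ∈ ltSpan b ζ wt gen (wt u + listWt wt l) := by
  induction l generalizing u with
  | nil =>
    obtain ⟨f', h, h'⟩ := F.lie_vac u hu f
    rw [act_nil, h]
    rcases h' with rfl | h'
    · rw [map_zero]; exact Submodule.zero_mem _
    · exact Submodule.subset_span ⟨[], f', by simpa [listWt] using h', rfl⟩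
  | cons y l ih =>
    have h1 : ∀ u, ⁅b u, act k b l (ζ f)⁆ ∈ leSpan b ζ wt gen (wt u + listWt wt l) := by
      intro u
      by_cases hu : u ∈ gen
      · exact act_mem_leSpan (⟨u, hu⟩ :: l) f
      · rw [← sub_add_cancel ⁅b u, act k b l (ζ f)⁆ (s u • act k b l (ζ f))]
        refine Submodule.add_mem _ (ltSpan_le_leSpan _ (ih hu)) ?_
        by_cases hs : s u = 0
        · rw [hs, zero_smul]; exact Submodule.zero_mem _
        · rw [F.wt_eq_zero u hs, zero_add]
          exact Submodule.smul_mem _ _ (act_mem_leSpan l f)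
    have h2 : ⁅b u, act k b (y :: l) (ζ f)⁆ - s u • act k b (y :: l) (ζ f) =
        ⁅b y, ⁅b u, act k b l (ζ f)⁆ - s u • act k b l (ζ f)⁆ +
          ⁅⁅b u, b y⁆, act k b l (ζ f)⁆ := by
      rw [act_cons, leibniz_lie, lie_sub, lie_smul]; abel
    rw [h2, listWt]
    refine Submodule.add_mem _ ?_ ?_
    · rw [add_left_comm]
      exact lie_mem_ltSpan_of_gen y (ih hu)
    · rw [← add_assoc]
      exact ltLie_lie_mem (F.lie_mem u y) h1

theorem lie_act_mem (u : I) (l : List gen) (f : A) :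
    ⁅b u, act k b l (ζ f)⁆ ∈ leSpan b ζ wt gen (wt u + listWt wt l) := by
  by_cases hu : u ∈ gen
  · exact act_mem_leSpan (⟨u, hu⟩ :: l) f
  · rw [← sub_add_cancel ⁅b u, act k b l (ζ f)⁆ (s u • act k b l (ζ f))]
    refine Submodule.add_mem _ (ltSpan_le_leSpan _ (F.lie_act_of_notMem l f hu)) ?_
    by_cases hs : s u = 0
    · rw [hs, zero_smul]; exact Submodule.zero_mem _
    · rw [F.wt_eq_zero u hs, zero_add]
      exact Submodule.smul_mem _ _ (act_mem_leSpan l f)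

/-- Brackets lie strictly below the sum of the weights, so the associated graded action is
commutative. -/
theorem act_perm {l l' : List gen} (h : l.Perm l') (f : A) :
    act k b l (ζ f) - act k b l' (ζ f) ∈ ltSpan b ζ wt gen (listWt wt l) := by
  induction h with
  | nil => rw [sub_self]; exact Submodule.zero_mem _
  | cons x _ ih => rw [act_cons, act_cons, ← lie_sub]; exact lie_mem_ltSpan_of_gen x ih
  | swap x y l =>
    rw [act_cons, act_cons, act_cons, act_cons, ← lie_lie, listWt, listWt, ← add_assoc]
    exact ltLie_lie_mem (F.lie_mem y x) fun u => F.lie_act_mem u l f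
  | trans h1 _ ih1 ih2 =>
    rw [← listWt_perm wt h1] at ih2
    have := Submodule.add_mem _ ih1 ih2
    rwa [sub_add_sub_cancel] at this

end IsFrame

/-! #### Symbols -/

variable (b ζ wt) in
/-- The relation between a polynomial, homogeneous of weight `ω`, and the vectors with this
polynomial as their symbol. -/
def symbolRel (gen : Set I) (ω : Γ) : Submodule k (MvPolynomial gen A × V) :=
  Submodule.span k {p | ∃ (l : List gen) (f : A),
    (listWt wt l = ω ∧ p = (monomial (expo l) f, act k b l (ζ f))) ∨
    -- Lower-order vectors get symbol zero. A vector may have several symbols; uniqueness is never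
    -- needed.
    (listWt wt l < ω ∧ p = (0, act k b l (ζ f)))}

theorem symbolRel_of_mem_ltSpan {ω : Γ} {v : V} (hv : v ∈ ltSpan b ζ wt gen ω) :
    ((0 : MvPolynomial gen A), v) ∈ symbolRel b ζ wt gen ω := by
  have h : ltSpan b ζ wt gen ω ≤
      (symbolRel b ζ wt gen ω).comap (LinearMap.inr k (MvPolynomial gen A) V) :=
    Submodule.span_le.2 fun v ⟨l, f, hl, e⟩ => Submodule.subset_span ⟨l, f, Or.inr ⟨hl, by rw [e]; rfl⟩⟩
  exact h hv

theorem snd_mem_leSpan {ω : Γ} {p : MvPolynomial gen A × V} (hp : p ∈ symbolRel b ζ wt gen ω) :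
    p.2 ∈ leSpan b ζ wt gen ω := by
  have h : symbolRel b ζ wt gen ω ≤
      (leSpan b ζ wt gen ω).comap (LinearMap.snd k (MvPolynomial gen A) V) := by
    refine Submodule.span_le.2 ?_
    rintro _ ⟨l, f, ⟨hl, rfl⟩ | ⟨hl, rfl⟩⟩
    · exact Submodule.subset_span ⟨l, f, hl.le, rfl⟩
    · exact Submodule.subset_span ⟨l, f, hl.le, rfl⟩
  exact h hp

theorem monomial_mem_symbolRel (l : List gen) (f : A) :
    (monomial (expo l) f, act k b l (ζ f)) ∈ symbolRel b ζ wt gen (listWt wt l) :=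
  Submodule.subset_span ⟨l, f, Or.inl ⟨rfl, rfl⟩⟩

theorem exists_list_of_symbolRel {ω : Γ} {p : MvPolynomial gen A × V}
    (hp : p ∈ symbolRel b ζ wt gen ω) (M : gen →₀ ℕ) (hM : coeff M p.1 ≠ 0) :
    ∃ l : List gen, listWt wt l = ω ∧ expo l = M := by
  by_contra hcon
  apply hM
  induction hp using Submodule.span_induction with
  | zero => simp
  | add p q _ _ hp hq =>
    rw [Prod.fst_add, MvPolynomial.coeff_add]
    by_cases h1 : coeff M p.1 = 0
    · by_cases h2 : coeff M q.1 = 0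
      · rw [h1, h2, add_zero]
      · exact absurd (hq h2) h2
    · exact absurd (hp h1) h1
  | smul c p _ hp =>
    rw [Prod.smul_fst, MvPolynomial.coeff_smul]
    by_cases h1 : coeff M p.1 = 0
    · rw [h1, smul_zero]
    · exact absurd (hp h1) h1
  | mem p hp =>
    obtain ⟨l, f, ⟨hl, rfl⟩ | ⟨hl, rfl⟩⟩ := hp
    · classical
      rw [MvPolynomial.coeff_monomial, if_neg fun h => hcon ⟨l, hl, h⟩]
    · simp

theorem exists_list_of_mem_vars {ω : Γ} {p : MvPolynomial gen A × V}
    (hp : p ∈ symbolRel b ζ wt gen ω) {y : gen} (hy : y ∈ p.1.vars) :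
    ∃ l : List gen, listWt wt l = ω ∧ y ∈ l := by
  obtain ⟨M, hM, hyM⟩ := (MvPolynomial.mem_vars_iff_mem_support y).1 hy
  obtain ⟨l, hl, rfl⟩ := exists_list_of_symbolRel hp M (MvPolynomial.mem_support_iff.1 hM)
  refine ⟨l, hl, ?_⟩
  rw [← Multiset.mem_coe, ← toMultiset_expo, Finsupp.mem_toMultiset]
  exact hyM

variable (s) in
open Classical in
/-- The symbol of a basis element. -/
def basisSymbol (A : Type*) [CommRing A] [Algebra k A] (gen : Set I) (u : I) : MvPolynomial gen A :=
  if h : u ∈ gen then X ⟨u, h⟩ else C (algebraMap k A (s u))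

theorem basisSymbol_of_mem {u : I} (h : u ∈ gen) : basisSymbol s A gen u = X ⟨u, h⟩ := dif_pos h

theorem basisSymbol_of_notMem {u : I} (h : u ∉ gen) :
    basisSymbol s A gen u = C (algebraMap k A (s u)) := dif_neg h

theorem symbolRel_lie_of_gen (y : gen) {ω : Γ} {p : MvPolynomial gen A × V}
    (hp : p ∈ symbolRel b ζ wt gen ω) :
    (X y * p.1, ⁅b y, p.2⁆) ∈ symbolRel b ζ wt gen (wt y + ω) := by
  induction hp using Submodule.span_induction with
  | zero =>
    rw [Prod.fst_zero, Prod.snd_zero, mul_zero, lie_zero]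
    exact Submodule.zero_mem _
  | add p q _ _ hp hq =>
    have := Submodule.add_mem _ hp hq
    rwa [Prod.mk_add_mk, ← mul_add, ← lie_add] at this
  | smul c p _ hp =>
    have := Submodule.smul_mem _ c hp
    rwa [Prod.smul_mk, ← mul_smul_comm, ← lie_smul] at this
  | mem p hp =>
    obtain ⟨l, f, ⟨hl, rfl⟩ | ⟨hl, rfl⟩⟩ := hp
    · refine Submodule.subset_span ⟨y :: l, f, Or.inl ⟨congr_arg _ hl, ?_⟩⟩
      rw [expo, act_cons, MvPolynomial.X, MvPolynomial.monomial_mul, one_mul]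
    · refine Submodule.subset_span ⟨y :: l, f, Or.inr ⟨add_lt_add_right hl _, ?_⟩⟩
      rw [act_cons, mul_zero]

theorem C_algebraMap_mul (c : k) (P : MvPolynomial gen A) : C (algebraMap k A c) * P = c • P := by
  rw [← MvPolynomial.smul_eq_C_mul, algebraMap_smul]

namespace IsFrame

variable (F : IsFrame b ζ wt s gen)
include F

theorem symbolRel_lie_act (u : I) (l : List gen) (f : A) :
    (basisSymbol s A gen u * monomial (expo l) f, ⁅b u, act k b l (ζ f)⁆) ∈
      symbolRel b ζ wt gen (wt u + listWt wt l) := by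
  by_cases hu : u ∈ gen
  · rw [basisSymbol_of_mem hu]
    have h := symbolRel_lie_of_gen ⟨u, hu⟩
      (monomial_mem_symbolRel (b := b) (ζ := ζ) (wt := wt) l f)
    exact h
  · have h1 := symbolRel_of_mem_ltSpan (F.lie_act_of_notMem l f hu)
    have h2 : s u • ((monomial (expo l) f, act k b l (ζ f)) : MvPolynomial gen A × V) ∈
        symbolRel b ζ wt gen (wt u + listWt wt l) := by
      by_cases hs : s u = 0
      · rw [hs, zero_smul]; exact Submodule.zero_mem _
      · rw [F.wt_eq_zero u hs, zero_add]
        exact Submodule.smul_mem _ _ (monomial_mem_symbolRel l f)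
    have := Submodule.add_mem _ h1 h2
    rwa [Prod.smul_mk, Prod.mk_add_mk, sub_add_cancel, zero_add, ← C_algebraMap_mul,
      ← basisSymbol_of_notMem hu] at this

variable {x : 𝔤} {c : k} {δ : Γ}
  {D : Derivation A (MvPolynomial gen A) (MvPolynomial gen A)} {T : gen → Prop}

/-- By `[x, y v] = y [x, v] + [[x, y], v]`, the operator `x - c` acts on symbols as the derivation
whose value at a variable is the leading term of its bracket with `x`. The shift `δ` is that of
these leading terms and need not be the weight of `x`. -/
theorem symbolRel_derivation_act (hx : ∀ f, ⁅x, ζ f⁆ = c • ζ f)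
    (hD : ∀ y, T y → ∃ (u : I) (κ : k), (κ = 0 ∨ wt u = wt y + δ) ∧
      ⁅x, b y⁆ - κ • b u ∈ ltLie (k := k) b wt (wt y + δ) ∧ D (X y) = κ • basisSymbol s A gen u)
    (l : List gen) (hl : ∀ y ∈ l, T y) (f : A) :
    (D (monomial (expo l) f), ⁅x, act k b l (ζ f)⁆ - c • act k b l (ζ f)) ∈
      symbolRel b ζ wt gen (listWt wt l + δ) := by
  induction l with
  | nil =>
    rw [act_nil, hx, sub_self]
    have : D (monomial (expo []) f) = 0 := MvPolynomial.derivation_C D f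
    rw [this]
    exact Submodule.zero_mem _
  | cons y l ih =>
    obtain ⟨u, κ, hκ, hR, hDy⟩ := hD y (hl y List.mem_cons_self)
    have h1 := symbolRel_lie_of_gen y (ih fun y' hy' => hl y' (List.mem_cons_of_mem _ hy'))
    have h2 : κ • ((basisSymbol s A gen u * monomial (expo l) f, ⁅b u, act k b l (ζ f)⁆) :
        MvPolynomial gen A × V) ∈ symbolRel b ζ wt gen (listWt wt (y :: l) + δ) := by
      rcases hκ with rfl | hκ
      · rw [zero_smul]; exact Submodule.zero_mem _
      · have := Submodule.smul_mem _ κ (F.symbolRel_lie_act u l f)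
        rwa [hκ, add_right_comm] at this
    have h3 := symbolRel_of_mem_ltSpan (ltLie_lie_mem hR fun u => F.lie_act_mem u l f)
    rw [add_right_comm] at h3
    rw [← add_assoc] at h1
    have key : ((D (monomial (expo (y :: l)) f),
        ⁅x, act k b (y :: l) (ζ f)⁆ - c • act k b (y :: l) (ζ f)) : MvPolynomial gen A × V) =
        (X y * D (monomial (expo l) f), ⁅b y, ⁅x, act k b l (ζ f)⁆ - c • act k b l (ζ f)⁆) +
        κ • (basisSymbol s A gen u * monomial (expo l) f, ⁅b u, act k b l (ζ f)⁆) +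
        (0, ⁅⁅x, b y⁆ - κ • b u, act k b l (ζ f)⁆) := by
      have hm : monomial (expo (y :: l)) f = X y * monomial (expo l) f := by
        rw [expo, MvPolynomial.X, MvPolynomial.monomial_mul, one_mul]
      refine Prod.ext ?_ ?_
      · rw [Prod.fst_add, Prod.fst_add, Prod.smul_fst, hm, D.leibniz, hDy, smul_eq_mul,
          smul_eq_mul, add_zero, mul_smul_comm, mul_comm (monomial _ _)]
      · rw [Prod.snd_add, Prod.snd_add, Prod.smul_snd, act_cons, leibniz_lie, lie_sub, lie_smul,
          sub_lie, smul_lie]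
        have aux : ∀ p q r t : V, p + q - r = q - r + t + (p - t) := fun p q r t => by abel
        exact aux _ _ _ _
    rw [key]
    exact Submodule.add_mem _ (Submodule.add_mem _ h1 h2) h3

/-- The predicate `T` limits `hD` to generators that can occur in weight at most `ω`; some leading
terms are correct only for those. -/
theorem symbolRel_derivation (hx : ∀ f, ⁅x, ζ f⁆ = c • ζ f)
    (hD : ∀ y, T y → ∃ (u : I) (κ : k), (κ = 0 ∨ wt u = wt y + δ) ∧
      ⁅x, b y⁆ - κ • b u ∈ ltLie (k := k) b wt (wt y + δ) ∧ D (X y) = κ • basisSymbol s A gen u)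
    {ω : Γ} (hT : ∀ l : List gen, listWt wt l ≤ ω → ∀ y ∈ l, T y)
    {p : MvPolynomial gen A × V} (hp : p ∈ symbolRel b ζ wt gen ω) :
    (D p.1, ⁅x, p.2⁆ - c • p.2) ∈ symbolRel b ζ wt gen (ω + δ) := by
  induction hp using Submodule.span_induction with
  | zero =>
    rw [Prod.fst_zero, Prod.snd_zero, map_zero, lie_zero, smul_zero, sub_zero]
    exact Submodule.zero_mem _
  | add p q _ _ hp hq =>
    have := Submodule.add_mem _ hp hq
    rw [Prod.mk_add_mk, ← map_add, sub_add_sub_comm, ← lie_add, ← smul_add] at this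
    exact this
  | smul r p _ hp =>
    have := Submodule.smul_mem _ r hp
    rw [Prod.smul_mk, smul_sub, ← lie_smul, smul_comm r c, ← D.map_smul_of_tower] at this
    exact this
  | mem p hp =>
    obtain ⟨l, f, ⟨hl, rfl⟩ | ⟨hl, rfl⟩⟩ := hp
    · rw [← hl]
      exact F.symbolRel_derivation_act hx hD l (hT l hl.le) f
    · have h1 := F.symbolRel_derivation_act hx hD l (hT l hl.le) f
      rw [map_zero]
      exact symbolRel_of_mem_ltSpan
        (leSpan_le_ltSpan (add_lt_add_left hl δ) (snd_mem_leSpan h1))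

end IsFrame

/-! #### Evaluation of polynomials -/

variable (b ζ) in
/-- The evaluation of polynomials at the vectors `ζ f`, for an arbitrary fixed order of the factors
of each monomial. -/
def evalVec (gen : Set I) : MvPolynomial gen A →ₗ[k] V :=
  Finsupp.lsum k (fun M : gen →₀ ℕ => act k b (Finsupp.toMultiset M).toList ∘ₗ ζ) ∘ₗ
    (AddMonoidAlgebra.coeffLinearEquiv k :
      AddMonoidAlgebra A (gen →₀ ℕ) ≃ₗ[k] ((gen →₀ ℕ) →₀ A)).toLinearMap

theorem evalVec_monomial (M : gen →₀ ℕ) (f : A) :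
    evalVec b ζ gen (monomial M f) = act k b (Finsupp.toMultiset M).toList (ζ f) := by
  change Finsupp.lsum k _ (Finsupp.single M f) = _
  rw [Finsupp.lsum_single]; rfl

theorem expo_toList (M : gen →₀ ℕ) : expo (Finsupp.toMultiset M).toList = M := by
  classical
  apply Finsupp.orderIsoMultiset.injective
  change Finsupp.toMultiset _ = Finsupp.toMultiset M
  rw [toMultiset_expo, Multiset.coe_toList]

/-- Every nonzero polynomial has a nonzero top symbol. -/
theorem exists_symbolRel_evalVec (wt : I → Γ) {P : MvPolynomial gen A} (hP : P ≠ 0) :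
    ∃ ω Q, Q ≠ 0 ∧ (Q, evalVec b ζ gen P) ∈ symbolRel b ζ wt gen ω := by
  classical
  let W : (gen →₀ ℕ) → Γ := fun M => listWt wt (Finsupp.toMultiset M).toList
  obtain ⟨M₀, hM₀, hmax⟩ := P.support.exists_max_image W
    (Finset.nonempty_iff_ne_empty.2 (MvPolynomial.support_eq_empty.not.2 hP))
  -- The symbol is the part of `P` of maximal weight.
  refine ⟨W M₀, ∑ M ∈ P.support, if W M = W M₀ then monomial M (coeff M P) else 0, ?_, ?_⟩
  · intro h
    have h2 := congr_arg (coeff M₀) h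
    rw [MvPolynomial.coeff_sum, Finset.sum_eq_single M₀, if_pos rfl, MvPolynomial.coeff_monomial,
      if_pos rfl] at h2
    · exact MvPolynomial.mem_support_iff.1 hM₀ h2
    · intro M _ hM
      split_ifs
      · rw [MvPolynomial.coeff_monomial, if_neg hM]
      · simp
    · exact fun h => absurd hM₀ h
  · have h1 : evalVec b ζ gen P = ∑ M ∈ P.support, evalVec b ζ gen (monomial M (coeff M P)) := by
      rw [← map_sum, MvPolynomial.support_sum_monomial_coeff]
    rw [h1]
    have h2 : ((∑ M ∈ P.support, if W M = W M₀ then monomial M (coeff M P) else 0),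
        ∑ M ∈ P.support, evalVec b ζ gen (monomial M (coeff M P))) =
        ∑ M ∈ P.support, (((if W M = W M₀ then monomial M (coeff M P) else 0),
          evalVec b ζ gen (monomial M (coeff M P))) : MvPolynomial gen A × V) :=
      Prod.ext (by rw [Prod.fst_sum]) (by rw [Prod.snd_sum])
    rw [h2]
    refine Submodule.sum_mem _ fun M hM => ?_
    rw [evalVec_monomial]
    split_ifs with h
    · rw [← h]
      have := monomial_mem_symbolRel (b := b) (ζ := ζ) (wt := wt)
        (Finsupp.toMultiset M).toList (coeff M P)
      rwa [expo_toList] at this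
    · exact symbolRel_of_mem_ltSpan
        (Submodule.subset_span ⟨_, _, lt_of_le_of_ne (hmax M hM) h, rfl⟩)

/-- If basis elements outside `gen` preserve the vectors `ζ f`, then `evalVec` is surjective onto a
module generated by these vectors. -/
theorem evalVec_surjective (hb : Submodule.span k (Set.range b) = ⊤)
    (hvac : ∀ u ∉ gen, ∀ f : A, ∃ f', ⁅b u, ζ f⁆ = ζ f')
    (hζ : LieSubmodule.lieSpan k 𝔤 (Set.range ζ) = ⊤) :
    Function.Surjective (evalVec b ζ gen) := by
  -- With all weights equal to `1` the weight of a list is its length, and every element of `𝔤` lies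
  -- below weight `1 + 1`.
  have F : IsFrame b ζ (fun _ : I => (1 : ℤ)) (fun _ => (0 : k)) gen :=
    { lie_mem := fun u v => by
        have : ltLie (k := k) b (fun _ : I => (1 : ℤ)) (1 + 1) = ⊤ := by
          rw [ltLie, ← hb, ← Set.image_univ]
          congr 2
          ext u
          simp
        rw [this]; exact Submodule.mem_top
      wt_eq_zero := fun u h => absurd rfl h
      lie_vac := fun u hu f => by
        obtain ⟨f', h⟩ := hvac u hu f
        exact ⟨f', by rw [h, zero_smul, sub_zero], Or.inr one_pos⟩ }
  have hlen : ∀ l : List gen, listWt (fun _ : I => (1 : ℤ)) l = l.length := by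
    intro l
    induction l with
    | nil => rfl
    | cons y l ih => rw [listWt, ih, List.length_cons]; push_cast; ring
  have hact : ∀ n : ℕ, ∀ (l : List gen) (f : A), l.length = n →
      act k b l (ζ f) ∈ LinearMap.range (evalVec b ζ gen) := by
    intro n
    induction n using Nat.strong_induction_on with
    | _ n ih =>
      intro l f hl
      have hperm : l.Perm (Finsupp.toMultiset (expo l)).toList := by
        rw [toMultiset_expo, ← Multiset.coe_eq_coe, Multiset.coe_toList]
      have h1 := F.act_perm hperm f
      rw [← evalVec_monomial] at h1
      rw [← sub_add_cancel (act k b l (ζ f)) (evalVec b ζ gen (monomial (expo l) f))]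
      refine Submodule.add_mem _ ?_ ⟨_, rfl⟩
      refine (Submodule.span_le.2 ?_ : ltSpan b ζ _ gen _ ≤ LinearMap.range (evalVec b ζ gen)) h1
      rintro _ ⟨l', f', hl', rfl⟩
      rw [hlen, hlen] at hl'
      exact ih l'.length (by omega) l' f' rfl
  let P : LieSubmodule k 𝔤 V :=
    { Submodule.span k {v | ∃ (l : List gen) (f : A), v = act k b l (ζ f)} with
      lie_mem := fun {x m} hm => by
        have hx : x ∈ Submodule.span k (Set.range b) := by rw [hb]; exact Submodule.mem_top
        change m ∈ Submodule.span k _ at hm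
        change _ ∈ Submodule.span k _
        induction hm using Submodule.span_induction with
        | zero => rw [lie_zero]; exact Submodule.zero_mem _
        | add _ _ _ _ h h' => rw [lie_add]; exact Submodule.add_mem _ h h'
        | smul c _ _ h => rw [lie_smul]; exact Submodule.smul_mem _ c h
        | mem v hv =>
          obtain ⟨l, f, rfl⟩ := hv
          induction hx using Submodule.span_induction with
          | zero => rw [zero_lie]; exact Submodule.zero_mem _
          | add _ _ _ _ h h' => rw [add_lie]; exact Submodule.add_mem _ h h'
          | smul c _ _ h => rw [smul_lie]; exact Submodule.smul_mem _ c h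
          | mem x hx =>
            obtain ⟨u, rfl⟩ := hx
            refine Submodule.span_mono ?_ (F.lie_act_mem u l f)
            rintro _ ⟨l', f', -, rfl⟩
            exact ⟨l', f', rfl⟩ }
  have hP : P = ⊤ := by
    rw [eq_top_iff, ← hζ, LieSubmodule.lieSpan_le]
    rintro _ ⟨f, rfl⟩
    exact Submodule.subset_span ⟨[], f, rfl⟩
  intro v
  have hv : v ∈ Submodule.span k {v | ∃ (l : List gen) (f : A), v = act k b l (ζ f)} := by
    change v ∈ P
    rw [hP]; exact LieSubmodule.mem_top v
  refine (Submodule.span_le.2 ?_ : _ ≤ LinearMap.range (evalVec b ζ gen)) hv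
  rintro _ ⟨l, f, rfl⟩
  exact hact _ l f rfl

end Filtration

/-! ### The weights on `𝓛` -/

section Reduction

open MvPolynomial (X C monomial coeff pderiv)

/-- The elements `d i α` as a family. -/
def dFam (u : Fin 2 × (Fin 2 → ℤ)) : Der := d u.1 u.2

/-- The indices of the basis elements of `𝔟⁻` other than `z`. -/
def genSet : Set (Fin 2 × (Fin 2 → ℤ)) :=
  {u | (u.2 0 < 0 ∨ (u.2 0 = 0 ∧ u.2 1 ≤ 0)) ∧ ¬ (u.1 = 0 ∧ u.2 0 = 0 ∧ u.2 1 = 0)}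

/-- The lexicographic weight of `d i α`. -/
def lexWt (u : Fin 2 × (Fin 2 → ℤ)) : ℤ ×ₗ ℤ :=
  -- The offset `1` puts `d₁(ε₂)` in weight zero and `z` in positive weight. The offset `3` keeps
  -- `d₂(ε₂)` and `d₂(2ε₂)` in positive weight, so `ψ(d₁(ε₂))` is the only value of `ψ` seen in top
  -- weight. Both offsets being positive, brackets lose weight.
  toLex (-(u.2 0), (if u.1 = 0 then 1 else 3) - u.2 1)

/-- The scalar by which `d i α` acts in top weight, where `p = ψ(d₁(ε₂))`. -/
def topScalar (p : ℂ) (u : Fin 2 × (Fin 2 → ℤ)) : ℂ :=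
  if u.1 = 0 ∧ u.2 0 = 0 ∧ u.2 1 = 1 then p else 0

theorem lexWt_lt {u : Fin 2 × (Fin 2 → ℤ)} {m n : ℤ} :
    lexWt u < toLex (m, n) ↔
      -(u.2 0) < m ∨ (-(u.2 0) = m ∧ (if u.1 = 0 then 1 else 3) - u.2 1 < n) :=
  Prod.Lex.toLex_lt_toLex

theorem lexWt_add (u : Fin 2 × (Fin 2 → ℤ)) (m n : ℤ) :
    lexWt u + toLex (m, n) =
      toLex (-(u.2 0) + m, (if u.1 = 0 then 1 else 3) - u.2 1 + n) := rfl

theorem dFam_mem_ltLie {u : Fin 2 × (Fin 2 → ℤ)} {ω : ℤ ×ₗ ℤ} (h : lexWt u < ω) (c : ℂ) :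
    c • dFam u ∈ ltLie (k := ℂ) dFam lexWt ω :=
  Submodule.smul_mem _ _ (Submodule.subset_span ⟨u, h, rfl⟩)

theorem lie_dFam (u v : Fin 2 × (Fin 2 → ℤ)) : ⁅dFam u, dFam v⁆ =
    (v.2 u.1 : ℂ) • dFam (v.1, u.2 + v.2) - (u.2 v.1 : ℂ) • dFam (u.1, u.2 + v.2) :=
  lie_d _ _ _ _

theorem genSet_fst_nonpos (y : genSet) : y.1.2 0 ≤ 0 := by
  rcases y.2.1 with h | h <;> omega

theorem zero_le_lexWt (y : genSet) : 0 ≤ lexWt y := by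
  have h1 := y.2.1
  refine Prod.Lex.toLex_le_toLex.2 ?_
  change 0 < -(y.1.2 0) ∨ (0 = -(y.1.2 0) ∧ 0 ≤ (if y.1.1 = 0 then 1 else 3) - y.1.2 1)
  split_ifs <;> omega

variable {V A : Type*} [AddCommGroup V] [Module ℂ V] [LieRingModule Der V]
  [CommRing A] [Algebra ℂ A] {ζ : A →ₗ[ℂ] V} {ψ : LieAlgebra.LieCharacter ℂ Lplus} {a : A}

theorem lie_vac_of_notMem (hψ : ∀ (x : Lplus) f, ⁅(x : Der), ζ f⁆ = ψ x • ζ f)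
    (hz : ∀ f, ⁅d 0 0, ζ f⁆ = ζ (a * f)) {u : Fin 2 × (Fin 2 → ℤ)} (hu : u ∉ genSet) (f : A) :
    ∃ f', ⁅dFam u, ζ f⁆ = ζ f' := by
  obtain ⟨i, α⟩ := u
  by_cases h : α ∈ posCone
  · exact ⟨ψ ⟨d i α, d_mem_Lplus i h⟩ • f, by rw [map_smul]; exact hψ ⟨d i α, d_mem_Lplus i h⟩ f⟩
  · have h0 : i = 0 ∧ α 0 = 0 ∧ α 1 = 0 := by
      rw [mem_posCone] at h
      by_contra hcon
      exact hu ⟨by change α 0 < 0 ∨ (α 0 = 0 ∧ α 1 ≤ 0); omega, hcon⟩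
    have hα : α = 0 := by ext j; fin_cases j; exacts [h0.2.1, h0.2.2]
    refine ⟨a * f, ?_⟩
    rw [h0.1, hα]
    exact hz f

theorem isFrame_lexWt (hψ : ∀ (x : Lplus) f, ⁅(x : Der), ζ f⁆ = ψ x • ζ f)
    (hz : ∀ f, ⁅d 0 0, ζ f⁆ = ζ (a * f)) :
    IsFrame dFam ζ lexWt (topScalar (ψ ⟨d 0 eps2, d_mem_Lplus 0 eps2_mem⟩)) genSet where
  lie_mem u v := by
    rw [lie_dFam]
    refine Submodule.sub_mem _ (dFam_mem_ltLie ?_ _) (dFam_mem_ltLie ?_ _)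
    · refine (lexWt_lt (m := -(u.2 0) + -(v.2 0)) (n := ((if u.1 = 0 then 1 else 3) - u.2 1) +
        ((if v.1 = 0 then 1 else 3) - v.2 1))).2 (Or.inr ?_)
      simp only [Pi.add_apply]
      constructor
      · ring
      · split_ifs <;> omega
    · refine (lexWt_lt (m := -(u.2 0) + -(v.2 0)) (n := ((if u.1 = 0 then 1 else 3) - u.2 1) +
        ((if v.1 = 0 then 1 else 3) - v.2 1))).2 (Or.inr ?_)
      simp only [Pi.add_apply]
      constructor
      · ring
      · split_ifs <;> omega
  wt_eq_zero u h := by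
    rw [topScalar] at h
    split_ifs at h with h1
    · rw [lexWt, h1.1, h1.2.1, h1.2.2]; rfl
    · exact absurd rfl h
  lie_vac u hu f := by
    obtain ⟨f', hf'⟩ := lie_vac_of_notMem hψ hz hu f
    -- In positive weight every error is admissible, which covers `z`, `d₂(ε₂)` and `d₂(2ε₂)`.
    -- Otherwise the action must be exactly the top scalar, so `ψ` has to vanish away from `d₁(ε₂)`.
    by_cases hw : 0 < lexWt u
    · refine ⟨f' - topScalar (ψ ⟨d 0 eps2, d_mem_Lplus 0 eps2_mem⟩) u • f, ?_, Or.inr hw⟩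
      rw [hf', map_sub, map_smul]
    · refine ⟨0, ?_, Or.inl rfl⟩
      rw [map_zero, sub_eq_zero]
      obtain ⟨i, α⟩ := u
      have hw' : ¬ (0 < -(α 0) ∨ (0 = -(α 0) ∧ 0 < (if i = 0 then 1 else 3) - α 1)) :=
        fun h => hw (Prod.Lex.toLex_lt_toLex.2 h)
      have hpos : α ∈ posCone := by
        rw [mem_posCone]
        split_ifs at hw' <;> omega
      have hd : ⁅dFam (i, α), ζ f⁆ = ψ ⟨d i α, d_mem_Lplus i hpos⟩ • ζ f := hψ ⟨d i α, _⟩ f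
      rw [hd]
      congr 1
      rw [topScalar]
      split_ifs with h1
      · obtain ⟨h1, h2, h3⟩ := h1
        simp only at h1 h2 h3
        have hα : α = eps2 := by ext j; fin_cases j; exacts [h2, h3]
        subst h1 hα
        rfl
      · simp only at h1
        by_cases h0 : 0 < α 0
        · exact character_d_eq_zero_of_pos ψ i h0 hpos
        · have hα0 : α 0 = 0 := by rcases mem_posCone.1 hpos with h | h <;> omega
          obtain rfl | rfl : i = 0 ∨ i = 1 := by fin_cases i <;> simp
          · refine character_d_zero_eq_zero ψ hα0 ?_ hpos
            rw [if_pos rfl] at hw'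
            omega
          · refine character_d_one_eq_zero ψ hα0 ?_ hpos
            rw [if_neg (by decide)] at hw'
            omega

/-! ### Nonvanishing of the symbols -/

/-- Positive integers are units in a `ℂ`-algebra, so the factor produced by an exponent cannot kill
a coefficient, even if `A` has zero divisors. -/
theorem pderiv_ne_zero [Nontrivial A] {σ : Type*} {P : MvPolynomial σ A} {y : σ}
    (hy : y ∈ P.vars) : pderiv y P ≠ 0 := by
  obtain ⟨M, hM, hyM⟩ := (MvPolynomial.mem_vars_iff_mem_support y).1 hy
  intro h
  have h1 := MvPolynomial.coeff_pderiv (i := y) P (M - Finsupp.single y 1)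
  have h2 : M - Finsupp.single y 1 + Finsupp.single y 1 = M := by
    apply tsub_add_cancel_of_le
    rw [Finsupp.single_le_iff]
    exact Nat.one_le_iff_ne_zero.2 (Finsupp.mem_support_iff.1 hyM)
  rw [h, h2, MvPolynomial.coeff_zero] at h1
  generalize (M - Finsupp.single y 1 : σ →₀ ℕ) y = n at h1
  have h3 : (n : A) + 1 = algebraMap ℂ A (n + 1) := by simp
  have h4 : IsUnit (algebraMap ℂ A (n + 1)) := (IsUnit.mk0 _ (Nat.cast_add_one_ne_zero n)).map _
  rw [h3] at h1
  exact MvPolynomial.mem_support_iff.1 hM (h4.mul_left_eq_zero.1 h1.symm)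

theorem complex_smul_ne_zero {M : Type*} [AddCommGroup M] [Module ℂ M] {c : ℂ} {m : M}
    (hc : c ≠ 0) (hm : m ≠ 0) : c • m ≠ 0 := smul_ne_zero hc hm

/-- The derivation `X y ↦ κ y • basisSymbol (τ y)`. -/
def symbolDer (A : Type*) [CommRing A] [Algebra ℂ A] (p : ℂ) (κ : genSet → ℂ)
    (τ : genSet → Fin 2 × (Fin 2 → ℤ)) :
    Derivation A (MvPolynomial genSet A) (MvPolynomial genSet A) :=
  MvPolynomial.mkDerivation A fun y => κ y • basisSymbol (topScalar p) A genSet (τ y)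

theorem symbolDer_X (p : ℂ) (κ : genSet → ℂ) (τ : genSet → Fin 2 × (Fin 2 → ℤ)) (y : genSet) :
    symbolDer A p κ τ (X y) = κ y • basisSymbol (topScalar p) A genSet (τ y) :=
  MvPolynomial.mkDerivation_X _ _ _

/-- A derivation sending one variable to a new variable does not kill polynomials that involve the
former. -/
theorem symbolDer_ne_zero_of_new [Nontrivial A] {p : ℂ} {κ : genSet → ℂ}
    {τ : genSet → Fin 2 × (Fin 2 → ℤ)} (hτ : Function.Injective τ) {P : MvPolynomial genSet A}
    {y : genSet} (hy : y ∈ P.vars) (hκ : κ y ≠ 0) {t : genSet} (hty : τ y = t) (ht : t ∉ P.vars) :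
    symbolDer A p κ τ P ≠ 0 := by
  classical
  -- Applied to `P`, which does not involve `t`, this says `∂_t (D P) = κ_y ∂_y P`, and the
  -- right-hand side is nonzero.
  have key : ⁅(pderiv t : Derivation A _ _), symbolDer A p κ τ⁆ = κ y • pderiv y := by
    apply MvPolynomial.derivation_ext
    intro x
    rw [Derivation.commutator_apply, symbolDer_X, Derivation.map_smul_of_tower]
    have h1 : symbolDer A p κ τ (pderiv t (X x)) = 0 := by
      by_cases h : x = t
      · rw [h, MvPolynomial.pderiv_X_self, Derivation.map_one_eq_zero]
      · rw [MvPolynomial.pderiv_X_of_ne h, map_zero]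
    rw [h1, sub_zero, Derivation.smul_apply]
    by_cases hxy : x = y
    · subst hxy
      have hmem : τ x ∈ genSet := by rw [hty]; exact t.2
      have ht' : (⟨τ x, hmem⟩ : genSet) = t := Subtype.ext hty
      rw [basisSymbol_of_mem hmem, ht', MvPolynomial.pderiv_X_self, MvPolynomial.pderiv_X_self]
    · rw [MvPolynomial.pderiv_X_of_ne hxy, smul_zero]
      by_cases hmem : τ x ∈ genSet
      · have ht' : (⟨τ x, hmem⟩ : genSet) ≠ t := by
          rintro rfl
          exact hxy (hτ hty.symm)
        rw [basisSymbol_of_mem hmem, MvPolynomial.pderiv_X_of_ne ht', smul_zero]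
      · rw [basisSymbol_of_notMem hmem, MvPolynomial.pderiv_C, smul_zero]
  intro h
  have h2 := DFunLike.congr_fun key P
  rw [Derivation.commutator_apply, h, MvPolynomial.pderiv_eq_zero_of_notMem_vars ht, map_zero,
    map_zero, sub_zero, Derivation.smul_apply] at h2
  exact complex_smul_ne_zero hκ (pderiv_ne_zero hy) h2.symm

/-- A derivation sending one variable to a constant and killing the other variables of `P` does not
kill `P`. -/
theorem symbolDer_ne_zero_of_const [Nontrivial A] {p : ℂ} {κ : genSet → ℂ}
    {τ : genSet → Fin 2 × (Fin 2 → ℤ)} {P : MvPolynomial genSet A} {y : genSet} (hy : y ∈ P.vars)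
    {c : ℂ} (hc : c ≠ 0) (h : κ y • basisSymbol (topScalar p) A genSet (τ y) = c • 1)
    (h' : ∀ x ∈ P.vars, x ≠ y → κ x • basisSymbol (topScalar p) A genSet (τ x) = 0) :
    symbolDer A p κ τ P ≠ 0 := by
  have key : symbolDer A p κ τ P = (c • pderiv y : Derivation A _ _) P := by
    apply MvPolynomial.derivation_eq_of_forall_mem_vars
    intro x hx
    rw [symbolDer_X, Derivation.smul_apply]
    by_cases hxy : x = y
    · rw [hxy, h, MvPolynomial.pderiv_X_self]
    · rw [h' x hx hxy, MvPolynomial.pderiv_X_of_ne hxy, smul_zero]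
  rw [key, Derivation.smul_apply]
  exact complex_smul_ne_zero hc (pderiv_ne_zero hy)

end Reduction

/-! ### Reduction to the vectors `ζ f` -/

section Reduce

open MvPolynomial (X C monomial coeff pderiv)

variable {V A : Type*} [AddCommGroup V] [Module ℂ V] [LieRingModule Der V] [LieModule ℂ Der V]
  [CommRing A] [Algebra ℂ A] {ζ : A →ₗ[ℂ] V} {ψ : LieAlgebra.LieCharacter ℂ Lplus} {a : A}

theorem vec_mem_posCone {m n : ℤ} (h : 0 < m ∨ (m = 0 ∧ 0 < n)) :
    (![m, n] : Fin 2 → ℤ) ∈ posCone := mem_posCone.2 h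

/-- Lowering the first degree. -/
theorem symbolRel_step_lower (hψ : ∀ (x : Lplus) f, ⁅(x : Der), ζ f⁆ = ψ x • ζ f)
    (hz : ∀ f, ⁅d 0 0, ζ f⁆ = ζ (a * f)) {m r : ℤ} {p : MvPolynomial genSet A × V}
    (hp : p ∈ symbolRel dFam ζ lexWt genSet (toLex (m, r))) (n : ℤ) :
    (symbolDer A (ψ ⟨d 0 eps2, d_mem_Lplus 0 eps2_mem⟩)
        (fun y => (y.1.2 0 : ℂ) - if y.1.1 = 0 then 1 else 0)
        (fun y => (y.1.1, ![1, n] + y.1.2)) p.1, ⁅d 0 ![1, n], p.2⁆) ∈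
      symbolRel dFam ζ lexWt genSet (toLex (m - 1, r - n)) := by
  have F := isFrame_lexWt hψ hz
  have hpos : (![1, n] : Fin 2 → ℤ) ∈ posCone := vec_mem_posCone (by simp)
  have hx : ∀ f, ⁅d 0 ![1, n], ζ f⁆ = (0 : ℂ) • ζ f := fun f => by
    have h := hψ ⟨d 0 ![1, n], d_mem_Lplus 0 hpos⟩ f
    rwa [character_d_eq_zero_of_pos ψ 0 (by simp) hpos] at h
  have h := F.symbolRel_derivation (c := 0) (δ := toLex (-1, -n)) (T := fun _ => True) hx
    (D := symbolDer A (ψ ⟨d 0 eps2, d_mem_Lplus 0 eps2_mem⟩)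
      (fun y => (y.1.2 0 : ℂ) - if y.1.1 = 0 then 1 else 0)
      (fun y => (y.1.1, ![1, n] + y.1.2))) (fun y _ => ?_) (fun _ _ _ _ => trivial) hp
  · rw [zero_smul, sub_zero] at h
    exact h
  · refine ⟨_, _, Or.inr ?_, ?_, symbolDer_X _ _ _ _⟩
    · rw [lexWt_add, lexWt]
      simp only [Pi.add_apply, Matrix.cons_val_zero, Matrix.cons_val_one]
      congr 2
      · ring
      · ring
    · obtain ⟨⟨i, β⟩, hy⟩ := y
      obtain rfl | rfl : i = 0 ∨ i = 1 := by fin_cases i <;> simp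
      · have := lie_dFam (0, ![1, n]) (0, β)
        change ⁅dFam (0, ![1, n]), dFam (0, β)⁆ - _ ∈ _
        rw [this, ← sub_smul, if_pos rfl]
        simp
      · have := lie_dFam (0, ![1, n]) (1, β)
        change ⁅dFam (0, ![1, n]), dFam (1, β)⁆ - _ ∈ _
        rw [this]
        simp only [one_ne_zero, if_false, sub_zero, sub_sub_cancel_left]
        rw [← neg_smul]
        -- The leftover is a multiple of a `d₁`, whose offset `1` puts it below the leading `d₂`
        -- term of offset `3`.
        refine dFam_mem_ltLie ?_ _
        refine (lexWt_lt (m := -(β 0) + -1) (n := 3 - β 1 + -n)).2 (Or.inr ?_)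
        simp
        omega

/-- The generators occurring in lists of weight at most `(0, r)` have first degree zero. -/
theorem fst_eq_zero_of_listWt {r : ℤ} {l : List genSet} (hl : listWt lexWt l ≤ toLex (0, r))
    {y : genSet} (hy : y ∈ l) : y.1.2 0 = 0 := by
  have h := (le_listWt lexWt zero_le_lexWt hy).trans hl
  have h2 := genSet_fst_nonpos y
  rcases Prod.Lex.toLex_le_toLex.1 h with h3 | h3
  · have : -(y.1.2 0) < 0 := h3
    omega
  · have : -(y.1.2 0) = 0 := h3.1
    omega

/-- The action of `d₁(0, n)` on symbols of first degree zero. -/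
theorem symbolRel_step_d_zero (hψ : ∀ (x : Lplus) f, ⁅(x : Der), ζ f⁆ = ψ x • ζ f)
    (hz : ∀ f, ⁅d 0 0, ζ f⁆ = ζ (a * f)) {r : ℤ} {p : MvPolynomial genSet A × V}
    (hp : p ∈ symbolRel dFam ζ lexWt genSet (toLex (0, r))) {n : ℤ}
    (hpos : (![0, n] : Fin 2 → ℤ) ∈ posCone) :
    (symbolDer A (ψ ⟨d 0 eps2, d_mem_Lplus 0 eps2_mem⟩)
        (fun y => if y.1.1 = 0 then 0 else -(n : ℂ))
        (fun y => (0, ![0, n] + y.1.2)) p.1,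
      ⁅d 0 ![0, n], p.2⁆ - ψ ⟨d 0 ![0, n], d_mem_Lplus 0 hpos⟩ • p.2) ∈
      symbolRel dFam ζ lexWt genSet (toLex (0, r + (-2 - n))) := by
  have F := isFrame_lexWt hψ hz
  refine F.symbolRel_derivation (c := ψ ⟨d 0 ![0, n], d_mem_Lplus 0 hpos⟩)
    -- Here `d₂(0, m)` becomes a multiple of `d₁(0, m + n)`; the passage from offset `3` to offset
    -- `1` accounts for the extra `-2`.
    (δ := toLex (0, -2 - n)) (T := fun y => y.1.2 0 = 0)
    (hψ ⟨d 0 ![0, n], d_mem_Lplus 0 hpos⟩)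
    (D := symbolDer A (ψ ⟨d 0 eps2, d_mem_Lplus 0 eps2_mem⟩)
      (fun y => if y.1.1 = 0 then 0 else -(n : ℂ))
      (fun y => (0, ![0, n] + y.1.2))) (fun y hy => ?_)
    (fun l hl y hy => fst_eq_zero_of_listWt hl hy) hp
  obtain ⟨⟨i, β⟩, hyg⟩ := y
  refine ⟨_, _, ?_, ?_, symbolDer_X _ _ _ _⟩
  · obtain rfl | rfl : i = 0 ∨ i = 1 := by fin_cases i <;> simp
    · exact Or.inl rfl
    · right
      rw [lexWt_add, lexWt]
      simp only [Pi.add_apply, Matrix.cons_val_zero, Matrix.cons_val_one]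
      congr 2
      · ring
      · simp only [one_ne_zero, if_true, if_false]; ring
  · simp only at hy
    change ⁅dFam (0, ![0, n]), dFam (i, β)⁆ - _ ∈ _
    rw [lie_dFam]
    obtain rfl | rfl : i = 0 ∨ i = 1 := by fin_cases i <;> simp
    · simp [hy]
    · simp [hy]

/-- The action of `d₂(0, n)` on symbols of first degree zero. -/
theorem symbolRel_step_d_one (hψ : ∀ (x : Lplus) f, ⁅(x : Der), ζ f⁆ = ψ x • ζ f)
    (hz : ∀ f, ⁅d 0 0, ζ f⁆ = ζ (a * f)) {r : ℤ} {p : MvPolynomial genSet A × V}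
    (hp : p ∈ symbolRel dFam ζ lexWt genSet (toLex (0, r))) {n : ℤ}
    (hpos : (![0, n] : Fin 2 → ℤ) ∈ posCone) :
    (symbolDer A (ψ ⟨d 0 eps2, d_mem_Lplus 0 eps2_mem⟩)
        (fun y => (y.1.2 1 : ℂ) - if y.1.1 = 0 then 0 else (n : ℂ))
        (fun y => (y.1.1, ![0, n] + y.1.2)) p.1,
      ⁅d 1 ![0, n], p.2⁆ - ψ ⟨d 1 ![0, n], d_mem_Lplus 1 hpos⟩ • p.2) ∈
      symbolRel dFam ζ lexWt genSet (toLex (0, r + (-n))) := by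
  have F := isFrame_lexWt hψ hz
  refine F.symbolRel_derivation (c := ψ ⟨d 1 ![0, n], d_mem_Lplus 1 hpos⟩)
    (δ := toLex (0, -n)) (T := fun y => y.1.2 0 = 0)
    (hψ ⟨d 1 ![0, n], d_mem_Lplus 1 hpos⟩)
    (D := symbolDer A (ψ ⟨d 0 eps2, d_mem_Lplus 0 eps2_mem⟩)
      (fun y => (y.1.2 1 : ℂ) - if y.1.1 = 0 then 0 else (n : ℂ))
      (fun y => (y.1.1, ![0, n] + y.1.2))) (fun y hy => ?_)
    (fun l hl y hy => fst_eq_zero_of_listWt hl hy) hp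
  obtain ⟨⟨i, β⟩, hyg⟩ := y
  refine ⟨_, _, Or.inr ?_, ?_, symbolDer_X _ _ _ _⟩
  · rw [lexWt_add, lexWt]
    simp only [Pi.add_apply, Matrix.cons_val_zero, Matrix.cons_val_one]
    congr 2
    · ring
    · ring
  · simp only at hy
    change ⁅dFam (1, ![0, n]), dFam (i, β)⁆ - _ ∈ _
    rw [lie_dFam]
    obtain rfl | rfl : i = 0 ∨ i = 1 := by fin_cases i <;> simp
    · simp
    · simp [← sub_smul]

/-! ### Nonvanishing of the lowered symbols -/

theorem exists_fst_neg {m r : ℤ} (hm : m ≠ 0) {p : MvPolynomial genSet A × V}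
    (hp : p ∈ symbolRel dFam ζ lexWt genSet (toLex (m, r))) (hne : p.1 ≠ 0) :
    ∃ y ∈ p.1.vars, y.1.2 0 < 0 := by
  by_contra! hcon
  obtain ⟨M, hM⟩ := MvPolynomial.ne_zero_iff.1 hne
  obtain ⟨l, hl, rfl⟩ := exists_list_of_symbolRel hp M hM
  have hall : ∀ y ∈ l, y.1.2 0 = 0 := by
    intro y hy
    refine le_antisymm (genSet_fst_nonpos y) (hcon y ?_)
    refine (MvPolynomial.mem_vars_iff_mem_support y).2
      ⟨_, MvPolynomial.mem_support_iff.2 hM, ?_⟩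
    rw [← Finsupp.mem_toMultiset, toMultiset_expo]
    exact hy
  have hzero : ∀ l : List genSet, (∀ y ∈ l, y.1.2 0 = 0) → (ofLex (listWt lexWt l)).1 = 0 := by
    intro l
    induction l with
    | nil => intro _; rfl
    | cons y l ih =>
      intro h
      change -(y.1.2 0) + (ofLex (listWt lexWt l)).1 = 0
      rw [ih fun y' hy' => h y' (List.mem_cons_of_mem _ hy'), h y List.mem_cons_self]
      rfl
  have := hzero l hall
  rw [hl] at this
  exact hm this

theorem exists_lower_ne_zero [Nontrivial A] (c : ℂ) {P : MvPolynomial genSet A} {y : genSet}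
    (hy : y ∈ P.vars) (hy0 : y.1.2 0 < 0) :
    ∃ n : ℤ, symbolDer A c (fun y => (y.1.2 0 : ℂ) - if y.1.1 = 0 then 1 else 0)
        (fun y => (y.1.1, ![1, n] + y.1.2)) P ≠ 0 := by
  let B : ℤ := ∑ x ∈ P.vars, |x.1.2 1|
  have hB : ∀ x ∈ P.vars, |x.1.2 1| ≤ B := fun x hx =>
    Finset.single_le_sum (f := fun x : genSet => |x.1.2 1|) (fun x _ => abs_nonneg _) hx
  -- Second degrees of variables of `P` lie in `[-B, B]`; this `n` moves `y` to second degree at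
  -- most `-B - 1`, hence to a variable absent from `P`.
  refine ⟨-2 * B - 1, ?_⟩
  have hyB := abs_le.1 (hB y hy)
  have ht : (y.1.1, ![1, -2 * B - 1] + y.1.2) ∈ genSet := by
    refine ⟨?_, ?_⟩
    · simp only [Pi.add_apply, Matrix.cons_val_zero, Matrix.cons_val_one, Matrix.cons_val_fin_one]
      omega
    · simp only [Pi.add_apply, Matrix.cons_val_zero, Matrix.cons_val_one, Matrix.cons_val_fin_one]
      omega
  refine symbolDer_ne_zero_of_new ?_ hy ?_ (t := ⟨_, ht⟩) rfl ?_
  · rintro ⟨⟨i, α⟩, h⟩ ⟨⟨j, β⟩, h'⟩ e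
    simp only [Prod.mk.injEq, add_right_inj] at e
    exact Subtype.ext (Prod.ext e.1 e.2)
  · have h1 : ((y.1.2 0 - if y.1.1 = 0 then 1 else 0 : ℤ) : ℂ) ≠ 0 := by
      rw [Int.cast_ne_zero]
      split_ifs <;> omega
    intro h
    apply h1
    push_cast
    exact h
  · intro hmem
    have h1 := abs_le.1 (hB _ hmem)
    simp only [Pi.add_apply, Matrix.cons_val_one, Matrix.cons_val_fin_one] at h1
    omega

theorem basisSymbol_eps2 (c : ℂ) {u : Fin 2 × (Fin 2 → ℤ)} (h0 : u.1 = 0) (h1 : u.2 0 = 0)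
    (h2 : u.2 1 = 1) : basisSymbol (topScalar c) A genSet u = c • 1 := by
  have hu : u ∉ genSet := fun h => by have := h.1; omega
  rw [basisSymbol_of_notMem hu, topScalar, if_pos ⟨h0, h1, h2⟩, Algebra.smul_def, mul_one]
  rfl

theorem basisSymbol_eq_zero (c : ℂ) {u : Fin 2 × (Fin 2 → ℤ)} (h1 : u.2 0 = 0) (h2 : 1 < u.2 1) :
    basisSymbol (topScalar c) A genSet u = 0 := by
  have hu : u ∉ genSet := fun h => by have := h.1; omega
  rw [basisSymbol_of_notMem hu, topScalar, if_neg (by omega), map_zero, map_zero]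

/-- Let `m` be the least second degree of a `d₂`-variable. Then `d₁(0, 1 - m)` sends `d₂(0, m)` to a
nonzero multiple of `d₁(ε₂)`, a constant symbol; the other `d₂`-variables go beyond `ε₂`, where
symbols vanish, and `d₁`-variables are killed. -/
theorem d_zero_ne_zero [Nontrivial A] {c : ℂ} (hc : c ≠ 0) {P : MvPolynomial genSet A}
    (h0 : ∀ x ∈ P.vars, x.1.2 0 = 0) {y : genSet} (hy : y ∈ P.vars) (hy1 : y.1.1 ≠ 0)
    (hmin : ∀ x ∈ P.vars, x.1.1 ≠ 0 → y.1.2 1 ≤ x.1.2 1) :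
    symbolDer A c (fun x => if x.1.1 = 0 then 0 else -((1 - y.1.2 1 : ℤ) : ℂ))
        (fun x => (0, ![0, 1 - y.1.2 1] + x.1.2)) P ≠ 0 := by
  have hy2 : y.1.2 1 ≤ 0 := by
    have := y.2.1
    have := h0 y hy
    omega
  have hne : ((1 - y.1.2 1 : ℤ) : ℂ) ≠ 0 := by
    rw [Int.cast_ne_zero]; omega
  refine symbolDer_ne_zero_of_const hy (c := -((1 - y.1.2 1 : ℤ) : ℂ) * c)
    (mul_ne_zero (neg_ne_zero.2 hne) hc) ?_ ?_
  · rw [if_neg hy1, basisSymbol_eps2 c rfl (by simp [h0 y hy]) (by simp), smul_smul]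
  · intro x hx hxy
    split_ifs with h
    · rw [zero_smul]
    · have h3 := hmin x hx h
      have h4 : y.1.2 1 ≠ x.1.2 1 := by
        intro h4
        apply hxy
        refine Subtype.ext (Prod.ext ?_ ?_)
        · omega
        · ext j
          fin_cases j
          · exact (h0 x hx).trans (h0 y hy).symm
          · exact h4.symm
      rw [basisSymbol_eq_zero c (by simp [h0 x hx]) (by simp; omega), smul_zero]

/-- The same device with `d₂(0, 1 - m)` when only `d₁`-variables are left. The factor `m` is nonzero
because `z` is not a variable. -/
theorem d_one_ne_zero [Nontrivial A] {c : ℂ} (hc : c ≠ 0) {P : MvPolynomial genSet A}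
    (h0 : ∀ x ∈ P.vars, x.1.2 0 = 0) (h1 : ∀ x ∈ P.vars, x.1.1 = 0) {y : genSet}
    (hy : y ∈ P.vars) (hmin : ∀ x ∈ P.vars, y.1.2 1 ≤ x.1.2 1) :
    symbolDer A c (fun x => (x.1.2 1 : ℂ) - if x.1.1 = 0 then 0 else ((1 - y.1.2 1 : ℤ) : ℂ))
        (fun x => (x.1.1, ![0, 1 - y.1.2 1] + x.1.2)) P ≠ 0 := by
  have hy2 : y.1.2 1 ≠ 0 := by
    intro h
    exact y.2.2 ⟨h1 y hy, h0 y hy, h⟩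
  have hne : (y.1.2 1 : ℂ) ≠ 0 := Int.cast_ne_zero.2 hy2
  refine symbolDer_ne_zero_of_const hy (c := (y.1.2 1 : ℂ) * c) (mul_ne_zero hne hc) ?_ ?_
  · rw [if_pos (h1 y hy), basisSymbol_eps2 c (u := (y.1.1, ![0, 1 - y.1.2 1] + y.1.2)) (h1 y hy)
      (by simp [h0 y hy]) (by simp), smul_smul,
      sub_zero]
  · intro x hx hxy
    have h3 := hmin x hx
    have h4 : y.1.2 1 ≠ x.1.2 1 := by
      intro h4
      apply hxy
      refine Subtype.ext (Prod.ext ?_ ?_)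
      · exact (h1 x hx).trans (h1 y hy).symm
      · ext j
        fin_cases j
        · exact (h0 x hx).trans (h0 y hy).symm
        · exact h4.symm
    rw [basisSymbol_eq_zero c (by simp [h0 x hx]) (by simp; omega), smul_zero]

/-! ### Descent to weight zero -/

theorem lexWt_pos (y : genSet) : 0 < lexWt y := by
  have h1 := y.2
  refine Prod.Lex.toLex_lt_toLex.2 ?_
  change 0 < -(y.1.2 0) ∨ (0 = -(y.1.2 0) ∧ 0 < (if y.1.1 = 0 then 1 else 3) - y.1.2 1)
  have h2 := h1.1
  split_ifs <;> omega

theorem snd_eq_of_symbolRel_zero {p : MvPolynomial genSet A × V}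
    (hp : p ∈ symbolRel dFam ζ lexWt genSet 0) : p.2 = ζ (coeff 0 p.1) := by
  induction hp using Submodule.span_induction with
  | zero => simp
  | add p q _ _ hp hq => rw [Prod.snd_add, hp, hq, Prod.fst_add, MvPolynomial.coeff_add, map_add]
  | smul c p _ hp => rw [Prod.smul_snd, hp, Prod.smul_fst, MvPolynomial.coeff_smul, map_smul]
  | mem p hp =>
    obtain ⟨l, f, ⟨hl, rfl⟩ | ⟨hl, rfl⟩⟩ := hp
    · cases l with
      | nil =>
        change ζ f = ζ (coeff 0 (monomial 0 f))
        rw [MvPolynomial.coeff_monomial, if_pos rfl]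
      | cons y l =>
        have := le_listWt lexWt zero_le_lexWt (List.mem_cons_self (a := y) (l := l))
        rw [hl] at this
        exact absurd this (lexWt_pos y).not_ge
    · exact absurd hl (listWt_nonneg lexWt zero_le_lexWt l).not_gt

variable [Nontrivial A]

/-- Induction on a bound for the second weight, which each operator lowers since `1 - m ≥ 1`. The
`d₂`-variables are used first; once no variable is left, the symbol is a nonzero constant. -/
theorem exists_vac_of_fst_zero (hψ : ∀ (x : Lplus) f, ⁅(x : Der), ζ f⁆ = ψ x • ζ f)
    (hz : ∀ f, ⁅d 0 0, ζ f⁆ = ζ (a * f))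
    (hc : ψ ⟨d 0 eps2, d_mem_Lplus 0 eps2_mem⟩ ≠ 0) (K : LieSubmodule ℂ Der V) (n : ℕ) :
    ∀ (r : ℤ) (p : MvPolynomial genSet A × V), r < n →
      p ∈ symbolRel dFam ζ lexWt genSet (toLex (0, r)) → p.1 ≠ 0 → p.2 ∈ K →
      ∃ f ≠ 0, ζ f ∈ K := by
  induction n with
  | zero =>
    intro r p hr hp hne _
    obtain ⟨M, hM⟩ := MvPolynomial.ne_zero_iff.1 hne
    obtain ⟨l, hl, rfl⟩ := exists_list_of_symbolRel hp M hM
    have h := listWt_nonneg lexWt zero_le_lexWt l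
    rw [hl] at h
    rcases Prod.Lex.toLex_le_toLex.1 h with h3 | h3
    · exact absurd h3 (lt_irrefl (0 : ℤ))
    · have : (0 : ℤ) ≤ r := h3.2
      simp only [Nat.cast_zero] at hr
      omega
  | succ n ih =>
    intro r p hr hp hne hK
    have h0 : ∀ x ∈ p.1.vars, x.1.2 0 = 0 := by
      intro x hx
      obtain ⟨l, hl, hxl⟩ := exists_list_of_mem_vars hp hx
      exact fst_eq_zero_of_listWt hl.le hxl
    by_cases hvars : p.1.vars.Nonempty
    · by_cases hd : ∃ y ∈ p.1.vars, y.1.1 ≠ 0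
      · obtain ⟨y, hy, hmin⟩ := (p.1.vars.filter fun y => y.1.1 ≠ 0).exists_min_image
          (fun y => y.1.2 1) (by obtain ⟨y, hy⟩ := hd; exact ⟨y, Finset.mem_filter.2 hy⟩)
        rw [Finset.mem_filter] at hy
        have hy2 : y.1.2 1 ≤ 0 := by
          have := y.2.1
          have := h0 y hy.1
          omega
        have hpos : (![0, 1 - y.1.2 1] : Fin 2 → ℤ) ∈ posCone := vec_mem_posCone (by omega)
        have hne' := d_zero_ne_zero hc h0 hy.1 hy.2
          fun x hx hx1 => hmin x (Finset.mem_filter.2 ⟨hx, hx1⟩)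
        exact ih _ _ (by push_cast at hr; omega) (symbolRel_step_d_zero hψ hz hp hpos) hne'
          (K.sub_mem (K.lie_mem hK) (K.smul_mem _ hK))
      · push Not at hd
        obtain ⟨y, hy, hmin⟩ := p.1.vars.exists_min_image (fun y => y.1.2 1) hvars
        have hy2 : y.1.2 1 ≤ 0 := by
          have := y.2.1
          have := h0 y hy
          omega
        have hpos : (![0, 1 - y.1.2 1] : Fin 2 → ℤ) ∈ posCone := vec_mem_posCone (by omega)
        have hne' := d_one_ne_zero hc h0 hd hy hmin
        exact ih _ _ (by push_cast at hr; omega) (symbolRel_step_d_one hψ hz hp hpos) hne'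
          (K.sub_mem (K.lie_mem hK) (K.smul_mem _ hK))
    · obtain ⟨M, hM⟩ := MvPolynomial.ne_zero_iff.1 hne
      obtain ⟨l, hl, rfl⟩ := exists_list_of_symbolRel hp M hM
      obtain rfl : l = [] := by
        refine List.eq_nil_iff_forall_not_mem.2 fun y hy => hvars ⟨y, ?_⟩
        refine (MvPolynomial.mem_vars_iff_mem_support y).2
          ⟨_, MvPolynomial.mem_support_iff.2 hM, ?_⟩
        rw [← Finsupp.mem_toMultiset, toMultiset_expo]
        exact hy
      rw [← hl] at hp
      exact ⟨coeff 0 p.1, hM, by rw [← snd_eq_of_symbolRel_zero hp]; exact hK⟩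

/-- Induction on the first weight. The very negative `n` may raise the second weight at each step,
so `r` stays arbitrary; the lexicographic order absorbs this. -/
theorem exists_vac_of_symbolRel (hψ : ∀ (x : Lplus) f, ⁅(x : Der), ζ f⁆ = ψ x • ζ f)
    (hz : ∀ f, ⁅d 0 0, ζ f⁆ = ζ (a * f))
    (hc : ψ ⟨d 0 eps2, d_mem_Lplus 0 eps2_mem⟩ ≠ 0) (K : LieSubmodule ℂ Der V) (m : ℕ) :
    ∀ (r : ℤ) (p : MvPolynomial genSet A × V),
      p ∈ symbolRel dFam ζ lexWt genSet (toLex ((m : ℤ), r)) → p.1 ≠ 0 → p.2 ∈ K →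
      ∃ f ≠ 0, ζ f ∈ K := by
  induction m with
  | zero =>
    intro r p hp hne hK
    exact exists_vac_of_fst_zero hψ hz hc K (r.toNat + 1) r p (by push_cast; omega) hp hne hK
  | succ m ih =>
    intro r p hp hne hK
    obtain ⟨y, hy, hy0⟩ := exists_fst_neg (by omega) hp hne
    obtain ⟨n, hn⟩ := exists_lower_ne_zero (ψ ⟨d 0 eps2, d_mem_Lplus 0 eps2_mem⟩) hy hy0
    have h := symbolRel_step_lower hψ hz hp n
    rw [show (((m + 1 : ℕ) : ℤ) - 1) = m by push_cast; ring] at h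
    exact ih _ _ h hn (K.lie_mem hK)

/-- A submodule containing a vector that comes from a nonzero polynomial contains some `ζ f` with
`f ≠ 0`. -/
theorem exists_vac_mem (hψ : ∀ (x : Lplus) f, ⁅(x : Der), ζ f⁆ = ψ x • ζ f)
    (hz : ∀ f, ⁅d 0 0, ζ f⁆ = ζ (a * f))
    (hc : ψ ⟨d 0 eps2, d_mem_Lplus 0 eps2_mem⟩ ≠ 0) (K : LieSubmodule ℂ Der V)
    {P : MvPolynomial genSet A} (hP : P ≠ 0) (hK : evalVec dFam ζ genSet P ∈ K) :
    ∃ f ≠ 0, ζ f ∈ K := by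
  obtain ⟨ω, Q, hQ, hrel⟩ := exists_symbolRel_evalVec (b := dFam) (ζ := ζ) lexWt hP
  obtain ⟨M, hM⟩ := MvPolynomial.ne_zero_iff.1 hQ
  obtain ⟨l, hl, -⟩ := exists_list_of_symbolRel hrel M hM
  have h := listWt_nonneg lexWt zero_le_lexWt l
  rw [hl] at h
  have h1 : (0 : ℤ) ≤ (ofLex ω).1 := by
    rcases Prod.Lex.toLex_le_toLex.1 h with h3 | h3
    · exact le_of_lt h3
    · exact le_of_eq h3.1
  obtain ⟨m, hm⟩ := Int.eq_ofNat_of_zero_le h1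
  refine exists_vac_of_symbolRel hψ hz hc K m (ofLex ω).2 (Q, _) ?_ hQ hK
  rw [← hm]
  exact hrel

end Reduce

open UniversalEnvelopingAlgebra (ι)

/-! ### Simple Whittaker modules -/

theorem evalVec_comp_mulLeft {𝔤 V I A : Type*} [AddCommGroup V] [Module ℂ V] [LieRing 𝔤] [LieAlgebra ℂ 𝔤] [LieRingModule 𝔤 V]
    [LieModule ℂ 𝔤 V] [CommRing A] [Algebra ℂ A] (b : I → 𝔤) (gen : Set I) (ζ : A →ₗ[ℂ] V) (a : A)
    (P : MvPolynomial gen A) :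
    evalVec b (ζ ∘ₗ LinearMap.mulLeft ℂ a) gen P = evalVec b ζ gen (MvPolynomial.C a * P) := by
  induction P using MvPolynomial.induction_on' with
  | monomial M f =>
    rw [MvPolynomial.C_mul_monomial, evalVec_monomial, evalVec_monomial]; rfl
  | add p q hp hq => rw [map_add, hp, hq, mul_add, map_add]

section Simple

variable {V : Type*} [AddCommGroup V] [Module ℂ V] [LieRingModule Der V] [LieModule ℂ Der V]
  {ψ : LieAlgebra.LieCharacter ℂ Lplus}

theorem Nonsingular.apply_ne_zero (hψ : Nonsingular ψ) :
    ψ ⟨d 0 eps2, d_mem_Lplus 0 eps2_mem⟩ ≠ 0 :=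
  hψ _ (Set.mem_insert _ _)

theorem evalVec_dFam_surjective {A : Type*} [CommRing A] [Algebra ℂ A] {ζ : A →ₗ[ℂ] V} {a : A}
    (hζ : ∀ (x : Lplus) f, ⁅(x : Der), ζ f⁆ = ψ x • ζ f)
    (hz : ∀ f, ⁅d 0 0, ζ f⁆ = ζ (a * f))
    (hspan : LieSubmodule.lieSpan ℂ Der (Set.range ζ) = ⊤) :
    Function.Surjective (evalVec dFam ζ genSet) :=
  evalVec_surjective span_d (fun _ hu f => lie_vac_of_notMem hζ hz hu f) hspan

/-- A Whittaker module generated by an eigenvector of `z` is simple. -/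
theorem isIrreducible_of_eigenvector (hψ : Nonsingular ψ) {v : V} (hv : IsWhittakerVector ψ v)
    (hgen : LieSubmodule.lieSpan ℂ Der {v} = ⊤) {a : ℂ} (ha : ⁅d 0 0, v⁆ = a • v) :
    LieModule.IsIrreducible ℂ Der V := by
  have : Nontrivial V := ⟨v, 0, hv.1⟩
  refine LieModule.IsIrreducible.mk fun K hK => ?_
  let ζ : ℂ →ₗ[ℂ] V := LinearMap.toSpanSingleton ℂ V v
  have hζ : ∀ (x : Lplus) f, ⁅(x : Der), ζ f⁆ = ψ x • ζ f := fun x f => by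
    change ⁅(x : Der), f • v⁆ = ψ x • f • v
    rw [lie_smul, hv.2, smul_comm]
  have hz : ∀ f, ⁅d 0 0, ζ f⁆ = ζ (a * f) := fun f => by
    change ⁅d 0 0, f • v⁆ = (a * f) • v
    rw [lie_smul, ha, smul_smul, mul_comm]
  have hspan : LieSubmodule.lieSpan ℂ Der (Set.range ζ) = ⊤ := by
    rw [eq_top_iff, ← hgen]
    apply LieSubmodule.lieSpan_mono
    rintro _ rfl
    exact ⟨1, one_smul ℂ _⟩
  obtain ⟨m, hm, hm0⟩ := (Submodule.ne_bot_iff K.toSubmodule).1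
    (mt (LieSubmodule.toSubmodule_eq_bot K).1 hK)
  obtain ⟨P, rfl⟩ := evalVec_dFam_surjective hζ hz hspan m
  have hP : P ≠ 0 := by
    rintro rfl
    exact hm0 (map_zero _)
  obtain ⟨f, hf, hfK⟩ := exists_vac_mem hζ hz hψ.apply_ne_zero K hP hm
  have hvK : v ∈ K := by
    have := K.smul_mem f⁻¹ hfK
    change f⁻¹ • f • v ∈ K at this
    rwa [smul_smul, inv_mul_cancel₀ hf, one_smul] at this
  rw [eq_top_iff, ← hgen, LieSubmodule.lieSpan_le]
  rintro _ rfl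
  exact hvK

/-- The map `f ↦ f(z) v`. -/
def polyVec (v : V) : Polynomial ℂ →ₗ[ℂ] V :=
  LinearMap.applyₗ v ∘ₗ (Polynomial.aeval (LieModule.toEnd ℂ Der V (d 0 0))).toLinearMap

theorem polyVec_one (v : V) : polyVec v 1 = v := by
  change Polynomial.aeval (LieModule.toEnd ℂ Der V (d 0 0)) (1 : Polynomial ℂ) v = v
  rw [map_one]; rfl

theorem polyVec_X_mul (v : V) (f : Polynomial ℂ) :
    polyVec v (Polynomial.X * f) = ⁅d 0 0, polyVec v f⁆ := by
  change Polynomial.aeval (LieModule.toEnd ℂ Der V (d 0 0)) (Polynomial.X * f) v = _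
  rw [map_mul, Polynomial.aeval_X]; rfl

theorem lie_polyVec {v : V} (hv : ∀ x : Lplus, ⁅(x : Der), v⁆ = ψ x • v) (f : Polynomial ℂ)
    (x : Lplus) : ⁅(x : Der), polyVec v f⁆ = ψ x • polyVec v f := by
  have hX : ∀ n : ℕ, ∀ x : Lplus,
      ⁅(x : Der), polyVec v (Polynomial.X ^ n)⁆ = ψ x • polyVec v (Polynomial.X ^ n) := by
    intro n
    induction n with
    | zero => rw [pow_zero, polyVec_one]; exact hv
    | succ n ih =>
      rw [pow_succ', polyVec_X_mul]
      exact whittaker_lie_z ψ ih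
  induction f using Polynomial.induction_on' with
  | add f g hf hg => rw [map_add, lie_add, hf, hg, smul_add]
  | monomial n c =>
    rw [← Polynomial.smul_X_eq_monomial, map_smul, lie_smul, hX, smul_comm]

/-- If the map were injective, the vectors `z f(z)v` would generate the simple module, so `v` would
be the value of some `X·P`. Then `1 - X·P` has value zero and is nonzero, `X` not being a unit;
`exists_vac_mem` for the zero submodule gives `f ≠ 0` with `f(z)v = 0`. -/
theorem polyVec_not_injective (hψ : Nonsingular ψ) [LieModule.IsIrreducible ℂ Der V] {v : V}
    (hv : ∀ x : Lplus, ⁅(x : Der), v⁆ = ψ x • v) : ¬ Function.Injective (polyVec v) := by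
  intro hinj
  let ζ := polyVec v ∘ₗ LinearMap.mulLeft ℂ (Polynomial.X : Polynomial ℂ)
  have hz : ∀ f, ⁅d 0 0, polyVec v f⁆ = polyVec v (Polynomial.X * f) :=
    fun f => (polyVec_X_mul v f).symm
  have hspan : LieSubmodule.lieSpan ℂ Der (Set.range ζ) = ⊤ := by
    refine (IsSimpleOrder.eq_bot_or_eq_top _).resolve_left fun h => ?_
    have h1 : ζ 1 ∈ LieSubmodule.lieSpan ℂ Der (Set.range ζ) :=
      LieSubmodule.subset_lieSpan ⟨1, rfl⟩
    rw [h, LieSubmodule.mem_bot] at h1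
    have h2 : polyVec v (Polynomial.X * 1) = polyVec v 0 := h1.trans (map_zero _).symm
    have h3 := hinj h2
    rw [mul_one] at h3
    exact Polynomial.X_ne_zero h3
  obtain ⟨P, hP⟩ := evalVec_dFam_surjective (ζ := ζ) (a := Polynomial.X) (ψ := ψ)
    (fun x f => lie_polyVec hv _ x) (fun f => hz _) hspan v
  rw [evalVec_comp_mulLeft] at hP
  have h1 : evalVec dFam (polyVec v) genSet (1 : MvPolynomial genSet (Polynomial ℂ)) = v := by
    have := evalVec_monomial (b := dFam) (ζ := polyVec v) (gen := genSet) 0 1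
    rw [map_zero, Multiset.toList_zero, act_nil, polyVec_one] at this
    exact this
  have hne : (1 : MvPolynomial genSet (Polynomial ℂ)) - MvPolynomial.C Polynomial.X * P ≠ 0 := by
    intro h
    have h2 := congr_arg (MvPolynomial.coeff 0) (sub_eq_zero.1 h)
    rw [MvPolynomial.coeff_C_mul, MvPolynomial.coeff_zero_one] at h2
    exact Polynomial.not_isUnit_X (IsUnit.of_mul_eq_one _ h2.symm)
  obtain ⟨f, hf, hf0⟩ := exists_vac_mem (ζ := polyVec v) (a := Polynomial.X)
    (fun x f => lie_polyVec hv f x) hz hψ.apply_ne_zero ⊥ hne (by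
      rw [map_sub, h1, hP, sub_self]; exact LieSubmodule.zero_mem _)
  rw [LieSubmodule.mem_bot] at hf0
  exact hf (hinj (hf0.trans (map_zero _).symm))

/-- Strip linear factors `X - a` off `f`; as soon as the cofactor `g` no longer kills `v`, the
vector `g(z)v` is an eigenvector for `a`. -/
theorem exists_eigenvector_of_polyVec {v : V} (hv : v ≠ 0) (n : ℕ) :
    ∀ f : Polynomial ℂ, f.natDegree = n → f ≠ 0 → polyVec v f = 0 →
      ∃ (g : Polynomial ℂ) (a : ℂ), polyVec v g ≠ 0 ∧ ⁅d 0 0, polyVec v g⁆ = a • polyVec v g := by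
  induction n with
  | zero =>
    intro f hdeg hf hf0
    rw [Polynomial.eq_C_of_natDegree_eq_zero hdeg] at hf hf0
    rw [← mul_one (Polynomial.C _), ← Polynomial.smul_eq_C_mul, map_smul, polyVec_one] at hf0
    rcases smul_eq_zero.1 hf0 with h | h
    · exact absurd (by rw [h, map_zero]) hf
    · exact absurd h hv
  | succ n ih =>
    intro f hdeg hf hf0
    obtain ⟨a, ha⟩ := IsAlgClosed.exists_root f
      (fun h => by
        have h' := Polynomial.natDegree_eq_of_degree_eq_some (n := 0) h
        omega)
    obtain ⟨g, rfl⟩ := Polynomial.dvd_iff_isRoot.2 ha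
    have hg : g ≠ 0 := right_ne_zero_of_mul hf
    by_cases h : polyVec v g = 0
    · refine ih g ?_ hg h
      rw [Polynomial.natDegree_mul (Polynomial.X_sub_C_ne_zero a) hg,
        Polynomial.natDegree_X_sub_C] at hdeg
      omega
    · refine ⟨g, a, h, ?_⟩
      rw [sub_mul, map_sub, polyVec_X_mul, ← Polynomial.smul_eq_C_mul, map_smul, sub_eq_zero] at hf0
      exact hf0

/-- A simple Whittaker module contains a Whittaker vector that is an eigenvector of `z`. -/
theorem exists_whittaker_eigenvector (hψ : Nonsingular ψ) [LieModule.IsIrreducible ℂ Der V] {v : V}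
    (hv : IsWhittakerVector ψ v) :
    ∃ (v' : V) (a : ℂ), IsWhittakerVector ψ v' ∧ ⁅d 0 0, v'⁆ = a • v' := by
  have hinj := polyVec_not_injective hψ hv.2
  rw [← LinearMap.ker_eq_bot, Submodule.eq_bot_iff] at hinj
  push Not at hinj
  obtain ⟨f, hf0, hf⟩ := hinj
  obtain ⟨g, a, hg, ha⟩ := exists_eigenvector_of_polyVec hv.1 _ f rfl hf hf0
  exact ⟨polyVec v g, a, ⟨hg, lie_polyVec hv.2 g⟩, ha⟩

end Simple

/-! ### The modules `L_{ψ,a}` -/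

section Quotient

variable {ψ : LieAlgebra.LieCharacter ℂ Lplus}

theorem smul_mem_lieSubmodule (K : LieSubmodule ℂ Der (W ψ)) {m : W ψ} (hm : m ∈ K) (u : UL) :
    u • m ∈ K := by
  let S : Submodule ℂ UL :=
    { carrier := {u | u • m ∈ K}
      zero_mem' := by
        change (0 : UL) • m ∈ K
        rw [zero_smul]; exact K.zero_mem
      add_mem' := fun {a b} ha hb => by
        change (a + b) • m ∈ K
        rw [add_smul]; exact K.add_mem ha hb
      smul_mem' := fun c a ha => by
        change (c • a) • m ∈ K
        rw [smul_assoc]; exact K.smul_mem c ha }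
  refine enveloping_induction S ?_ (fun x u hu => ?_) u
  · change (1 : UL) • m ∈ K
    rwa [one_smul]
  · change (ι ℂ x * u) • m ∈ K
    rw [mul_smul]
    exact K.lie_mem (x := x) hu

theorem eq_top_of_w_mem {K : LieSubmodule ℂ Der (W ψ)} (h : w ψ ∈ K) : K = ⊤ := by
  rw [eq_top_iff]
  intro m _
  obtain ⟨u, rfl⟩ := W.exists_smul ψ m
  exact smul_mem_lieSubmodule K h u

theorem N_le {a : ℂ} {K : LieSubmodule ℂ Der (W ψ)}
    (h : (z - algebraMap ℂ UL a) • w ψ ∈ K) : N ψ a ≤ K := by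
  rw [N, LieSubmodule.lieSpan_le]
  rintro _ ⟨u, rfl⟩
  exact smul_mem_lieSubmodule K h _

/-- The class of `w` in `L_{ψ,a}`. -/
def wbar (ψ : LieAlgebra.LieCharacter ℂ Lplus) (a : ℂ) : L ψ a :=
  LieSubmodule.Quotient.mk' (N ψ a) (w ψ)

theorem wbar_whittaker (a : ℂ) : IsWhittakerVector ψ (wbar ψ a) := by
  refine ⟨fun h => w_notMem_N ψ a ((LieSubmodule.Quotient.mk_eq_zero _).1 h), fun x => ?_⟩
  rw [wbar, ← LieModuleHom.map_lie, w_whittaker, map_smul]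

theorem lieSpan_wbar (a : ℂ) : LieSubmodule.lieSpan ℂ Der {wbar ψ a} = ⊤ := by
  have h : (LieSubmodule.lieSpan ℂ Der {wbar ψ a}).comap (LieSubmodule.Quotient.mk' (N ψ a)) = ⊤ :=
    eq_top_of_w_mem (LieSubmodule.subset_lieSpan (Set.mem_singleton _))
  rw [eq_top_iff]
  intro m _
  obtain ⟨m, rfl⟩ := LieSubmodule.Quotient.surjective_mk' (N ψ a) m
  have : m ∈ (LieSubmodule.lieSpan ℂ Der {wbar ψ a}).comap (LieSubmodule.Quotient.mk' (N ψ a)) := by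
    rw [h]; exact LieSubmodule.mem_top m
  exact this

theorem lie_z_wbar (a : ℂ) : ⁅d 0 0, wbar ψ a⁆ = a • wbar ψ a := by
  rw [← sub_eq_zero, wbar, ← LieModuleHom.map_lie, ← map_smul, ← map_sub, ← z_sub_smul]
  exact (LieSubmodule.Quotient.mk_eq_zero _).2 (z_sub_mem_N ψ a)

variable {V : Type*} [AddCommGroup V] [Module ℂ V] [LieRingModule Der V] [LieModule ℂ Der V]

/-- The homomorphism `L_{ψ,a} → V` given by a Whittaker vector with `z`-eigenvalue `a`. -/
def L.desc (a : ℂ) (v : V) (hv : ∀ x : Lplus, ⁅(x : Der), v⁆ = ψ x • v)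
    (ha : ⁅d 0 0, v⁆ = a • v) : L ψ a →ₗ⁅ℂ, Der⁆ V :=
  have h : N ψ a ≤ (W.descLie v hv).ker := N_le <| by
    rw [LieModuleHom.mem_ker, z_sub_smul, map_sub, LieModuleHom.map_lie, map_smul, W.descLie_w, ha,
      sub_self]
  { Submodule.liftQ (N ψ a).toSubmodule (W.descLie v hv : W ψ →ₗ[ℂ] V)
      (fun _ hm => h hm) with
    map_lie' := fun {x m} => by
      obtain ⟨m, rfl⟩ := LieSubmodule.Quotient.surjective_mk' (N ψ a) m
      exact LieModuleHom.map_lie (W.descLie v hv) x m }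

theorem L.desc_wbar (a : ℂ) (v : V) (hv : ∀ x : Lplus, ⁅(x : Der), v⁆ = ψ x • v)
    (ha : ⁅d 0 0, v⁆ = a • v) : L.desc a v hv ha (wbar ψ a) = v :=
  W.descLie_w v hv

theorem L.isIrreducible (hψ : Nonsingular ψ) (a : ℂ) : LieModule.IsIrreducible ℂ Der (L ψ a) :=
  isIrreducible_of_eigenvector hψ (wbar_whittaker a) (lieSpan_wbar a) (lie_z_wbar a)

/-- Schur's lemma: the map `L_{ψ,a} → V` is nonzero between simple modules. -/
theorem nonempty_equiv_L (hψ : Nonsingular ψ) [LieModule.IsIrreducible ℂ Der V] {a : ℂ} {v : V}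
    (hv : IsWhittakerVector ψ v) (ha : ⁅d 0 0, v⁆ = a • v) :
    Nonempty (V ≃ₗ⁅ℂ, Der⁆ L ψ a) := by
  have hL := L.isIrreducible hψ a
  let φ := L.desc a v hv.2 ha
  have hφ : φ (wbar ψ a) = v := L.desc_wbar a v hv.2 ha
  have hker : φ.ker = ⊥ := (IsSimpleOrder.eq_bot_or_eq_top _).resolve_right fun h => by
    have : wbar ψ a ∈ φ.ker := by rw [h]; exact LieSubmodule.mem_top _
    rw [LieModuleHom.mem_ker, hφ] at this
    exact hv.1 this
  have hrange : φ.range = ⊤ := (IsSimpleOrder.eq_bot_or_eq_top _).resolve_left fun h => by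
    have : v ∈ φ.range := ⟨_, hφ⟩
    rw [h, LieSubmodule.mem_bot] at this
    exact hv.1 this
  have hinj : Function.Injective φ := (LieModuleHom.ker_eq_bot φ).1 hker
  have hsurj : Function.Surjective φ := (LieModuleHom.range_eq_top φ).1 hrange
  exact ⟨LieModuleEquiv.symm
    { LinearEquiv.ofBijective (φ : L ψ a →ₗ[ℂ] V) ⟨hinj, hsurj⟩ with
      map_lie' := fun {x m} => LieModuleHom.map_lie φ x m }⟩

end Quotient

end TorusWhittaker

end

theorem corollary4p3 (ψ : LieAlgebra.LieCharacter ℂ TorusWhittaker.Lplus)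
    (hψ : TorusWhittaker.Nonsingular ψ) :
    (∀ a : ℂ,
      (TorusWhittaker.N ψ a : Set (TorusWhittaker.W ψ)) = TorusWhittaker.orbit ψ a ∧
      LieModule.IsIrreducible ℂ TorusWhittaker.Der (TorusWhittaker.L ψ a) ∧
      TorusWhittaker.IsWhittakerModule (TorusWhittaker.L ψ a) ψ) ∧
    (∀ (V : Type*) [AddCommGroup V] [Module ℂ V] [LieRingModule TorusWhittaker.Der V]
        [LieModule ℂ TorusWhittaker.Der V],
      LieModule.IsIrreducible ℂ TorusWhittaker.Der V →
      TorusWhittaker.IsWhittakerModule V ψ →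
      ∃ a : ℂ, Nonempty (V ≃ₗ⁅ℂ, TorusWhittaker.Der⁆ TorusWhittaker.L ψ a)) := by
  refine ⟨fun a => ⟨TorusWhittaker.coe_N ψ a, TorusWhittaker.L.isIrreducible hψ a,
    TorusWhittaker.wbar ψ a, TorusWhittaker.wbar_whittaker a, TorusWhittaker.lieSpan_wbar a⟩, ?_⟩
  intro V _ _ _ _ hV ⟨v, hv, _⟩
  obtain ⟨v', a, hv', ha⟩ := TorusWhittaker.exists_whittaker_eigenvector hψ hv
  exact ⟨a, TorusWhittaker.nonempty_equiv_L hψ hv' ha⟩
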